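/- Let $m,n,k$ be positive integers with $k\le mn$, and let $G$ be the rectangular grid graph with $m$ rows and $n$ columns. Put $A=\lfloor mn/k\rfloor$, $a=\lfloor\sqrt A\rfloor$, $\varphi=(1+\sqrt5)/2$, and write $m=da+r$ with $0\le r\le a-1$. Assume $n\ge m\ge a$. A *balanced partition* is a partition of the vertices of $G$ into $k$ parts, each with $A$ or $A+1$ vertices; it is *contiguous* if every part induces a connected subgraph. Let $\mathrm{OPT}$ be the minimum number of cut edges (edges with ends in different parts) over all balanced contiguous partitions. *$\varphi$-Cautious Striping* makes the parts one after another, each of size $A$ or $A+1$, with exactly $mn \bmod k$ parts of size $A+1$. 1. Divide the rows, from the top, into horizontal strips: if $r\le d$, strips of height $a$ and $a+1$ (in any number and order); if $r>d$ and $r>\lfloor a/\varphi\rfloor$, strips of height $a$ and one bottom strip of height $r$; if $r>d$ and $r\le\lfloor a/\varphi\rfloor$, strips of height $a$ and one bottom strip of height $a+r$. Let $S_2$ be that bottom strip (empty in the first case) and $S_1$ the set of the other strips. 2. In each strip of $S_1$ separately, going column by column from the left and down each column, cut off parts, and stop when the number of complete columns left in the strip is at least $\lfloor a/\varphi\rfloor$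 and at most $\lceil\varphi a\rceil$. It is also allowed to stop with more than $\lceil \varphi a\rceil$ complete columns left if cutting off another $A+1$ vertices would leave fewer than $\lfloor a/\varphi\rfloor$ complete columns (or if fewer than $A+1$ vertices are left). 3. Let $R$ be the set of unpartitioned vertices of $S_1$. Collect its vertices into parts, row by row from the top, each row being traversed from left to right or from right to left. 4. If the last part begun in $R$ is not complete, complete it by vertices of $S_2$; collect the other vertices of $S_2$ into parts. Here $S_2$ is traversed column by column from the right, each column from top to bottom or from bottom to top, the columns that meet a part begun in $R$ from top to bottom. The choices left open (strip heights, the order of the part sizes, the stopping points, the directions) are to be made so that the parts are contiguous. The following holds. (i) For all $m,n,k$ as above such choices exist, so that the algorithm returns a balanced contiguous partition; moreover, every execution, whatever its choices, returns a balanced partition. (ii) If in addition $d=\lfloor m/a\rfloor\ge3$ and $a\ge3$, then for every execution the number of cut edges of the returned partition is at most $15.25\cdot\mathrm{OPT}$. (iii) The ratio of the number of cut edges to $\mathrm{OPT}$ tends to $1$ as $a$, $m/a$ and $n/a$ tend to infinity, uniformly over all executions: for every $\varepsilon>0$ there is $N$ such that $a,\ m/a,\ n/a\ge N$ implies that the ratio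 differs from $1$ by less than $\varepsilon$. -/

import Mathlib

/-! Balanced contiguous partitions of a rectangular grid graph, and the striping algorithm with
golden-ratio stopping rule. A partition into `k` labelled parts is a map `f` to `Fin k`, the parts
being its fibres. Rows and columns are numbered from `0`, top to bottom and left to right.

The algorithm has four steps, in this order. Step 1: divide the rows into the strips of `S₁` and, below
them, possibly one more strip `S₂`. Step 2: from the left of each strip of `S₁`, cut off parts until
about `a` columns are left. Step 3: divide the unpartitioned region `R` of `S₁` into parts, row by
row. Step 4: complete a part left unfinished in `R` by vertices of `S₂`, and divide the rest of
`S₂` into parts, column by column from the right. -/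

namespace Striping

/-- The rectangular grid graph with `m` rows and `n` columns; a vertex is (row, column). -/
abbrev grid (m n : ℕ) : SimpleGraph (Fin m × Fin n) :=
  (SimpleGraph.pathGraph m).boxProd (SimpleGraph.pathGraph n)

/-- `A`, the minimum number of vertices of a part of a balanced partition. -/
def partSize (m n k : ℕ) : ℕ := m * n / k

/-- `a`, the integer part of the square root of `A`. -/
def side (m n k : ℕ) : ℕ := Nat.sqrt (partSize m n k)

/-- Each of the `k` parts has `A` or `A + 1` vertices. -/
def IsBalanced {m n k : ℕ} (f : Fin m × Fin n → Fin k) : Prop :=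
  ∀ i : Fin k, {v | f v = i}.ncard = partSize m n k ∨ {v | f v = i}.ncard = partSize m n k + 1

/-- Each part induces a connected (nonempty) subgraph of the grid. -/
def IsContiguous {m n k : ℕ} (f : Fin m × Fin n → Fin k) : Prop :=
  ∀ i : Fin k, ((grid m n).induce {v | f v = i}).Connected

/-- The number of edges of the grid whose two ends lie in different parts. -/
noncomputable def cutSize {m n k : ℕ} (f : Fin m × Fin n → Fin k) : ℕ :=
  {e ∈ (grid m n).edgeSet | ¬ (e.map f).IsDiag}.ncard

/-- The minimum number of cut edges of a balanced partition into `k` contiguous parts. -/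
noncomputable def opt (m n k : ℕ) : ℕ :=
  sInf {c | ∃ f : Fin m × Fin n → Fin k, IsBalanced f ∧ IsContiguous f ∧ cutSize f = c}

/-- The lower end `⌊a / φ⌋` of the stopping window. -/
noncomputable def lo (m n k : ℕ) : ℕ := ⌊(side m n k : ℝ) / Real.goldenRatio⌋₊

/-- The upper end `⌈φ a⌉` of the stopping window. -/
noncomputable def hi (m n k : ℕ) : ℕ := ⌈Real.goldenRatio * (side m n k : ℝ)⌉₊

/-- The height of the bottom strip `S₂` (`0` if there is none). With `m = d a + r`, `0 ≤ r < a`: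
no bottom strip if `r ≤ d`, otherwise height `r` if `r > ⌊a / φ⌋` and `a + r` if not. -/
noncomputable def bottomHeight (m n k : ℕ) : ℕ :=
  if m % side m n k ≤ m / side m n k then 0
  else if lo m n k < m % side m n k then m % side m n k
  else side m n k + m % side m n k

/-- The choices that an execution of the algorithm makes. -/
structure Choices where
  /-- number of horizontal strips in `S₁` -/
  strips : ℕ
  /-- height of the `i`-th strip of `S₁`, from the top -/
  height : ℕ → ℕ
  /-- number of parts cut off from the `i`-th strip of `S₁` in Step 2 -/
  count : ℕ → ℕ
  /-- number of vertices of the `t`-th part, in the order in which the parts are made -/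
  size : ℕ → ℕ
  /-- in Step 3, is row `x` traversed from left to right (`true`) or from right to left? -/
  leftToRight : ℕ → Bool
  /-- in Step 4, is column `y` traversed from top to bottom (`true`) or from bottom to top? -/
  topToBottom : ℕ → Bool

namespace Choices

variable (e : Choices)

/-- The first row of the `i`-th strip; `e.top e.strips` is the number of rows of `S₁`. -/
def top (i : ℕ) : ℕ := ∑ j ∈ Finset.range i, e.height j

/-- The index of the first part cut off from the `i`-th strip. -/
def start (i : ℕ) : ℕ := ∑ j ∈ Finset.range i, e.count j

/-- The total size of the parts with index less than `t`. -/
def total (t : ℕ) : ℕ := ∑ s ∈ Finset.range t, e.size s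

/-- The number of vertices of the `i`-th strip that are partitioned in Step 2. -/
def used (i : ℕ) : ℕ := ∑ s ∈ Finset.Ico (e.start i) (e.start (i + 1)), e.size s

/-- The strip of `S₁` that contains row `x`. -/
def stripOf (x : ℕ) : ℕ := ((Finset.range e.strips).filter (fun i => e.top (i + 1) ≤ x)).card

/-- The position of the vertex `(x, y)` within its strip of `S₁`, in top-to-bottom striping:
column by column from left to right, and down each column. -/
def pos (x y : ℕ) : ℕ := y * e.height (e.stripOf x) + (x - e.top (e.stripOf x))

/-- The number of vertices of row `x` (of `S₁`) that are partitioned in Step 2. They are the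
leftmost ones; the other vertices of the row belong to the region `R`. -/
def leftEnd (n x : ℕ) : ℕ :=
  ((Finset.range n).filter (fun y => e.pos x y < e.used (e.stripOf x))).card

/-- The number of vertices that the algorithm adds to parts before the vertex `(x, y)`.
Step 2: in each strip of `S₁`, by position in the strip. Step 3: the rest `R` of `S₁`, row by row
from the top, each row in its chosen direction. Step 4: the bottom strip `S₂`, column by column
from the right, each column in its chosen direction. -/
def rank (m n x y : ℕ) : ℕ :=
  if x < e.top e.strips then
    if e.pos x y < e.used (e.stripOf x) then e.total (e.start (e.stripOf x)) + e.pos x y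
    else e.total (e.start e.strips) + ∑ z ∈ Finset.range x, (n - e.leftEnd n z)
      + (if e.leftToRight x then y - e.leftEnd n x else n - 1 - y)
  else e.top e.strips * n + (n - 1 - y) * (m - e.top e.strips)
    + (if e.topToBottom y then x - e.top e.strips else m - 1 - x)

/-- The number of vertices of the `i`-th strip left unpartitioned by Step 2. -/
def rest (n i : ℕ) : ℕ := e.height i * n - e.used i

/-- The choices obey the rules of Steps 1 and 2 and of the part sizes. -/
structure Valid (m n k : ℕ) : Prop where
  /-- strips of `S₁` have height `a` or, when `r ≤ d`, also `a + 1` -/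
  height_eq : ∀ i < e.strips, e.height i = side m n k ∨
    (m % side m n k ≤ m / side m n k ∧ e.height i = side m n k + 1)
  /-- the strips of `S₁` and the bottom strip fill the `m` rows -/
  height_sum : e.top e.strips + bottomHeight m n k = m
  /-- each part has size `A` or `A + 1` -/
  size_eq : ∀ t < k, e.size t = partSize m n k ∨ e.size t = partSize m n k + 1
  /-- exactly `m n mod k` parts have size `A + 1` -/
  card_large :
    ((Finset.range k).filter (fun t => e.size t = partSize m n k + 1)).card = m * n % k
  /-- no more than `k` parts are made in Step 2 -/
  start_le : e.start e.strips ≤ k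
  /-- the parts cut off from a strip fit into it -/
  used_le : ∀ i < e.strips, e.used i ≤ e.height i * n
  /-- at least `⌊a / φ⌋` complete columns of each strip are left -/
  lo_le : ∀ i < e.strips, lo m n k ≤ e.rest n i / e.height i
  /-- at most `⌈φ a⌉` complete columns of each strip are left, unless cutting off another `A + 1`
  vertices would leave fewer than `⌊a / φ⌋` complete columns -/
  le_hi : ∀ i < e.strips, e.rest n i / e.height i ≤ hi m n k ∨
    e.rest n i < lo m n k * e.height i + (partSize m n k + 1)

end Choices

/-- `f` is the partition produced by some execution of the striping algorithm: the vertices, in the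
order in which the algorithm visits them, are collected into parts of the chosen sizes. If a part
begun in `R` is completed in `S₂`, this is done in top-to-bottom direction. -/
def IsOutput {m n k : ℕ} (f : Fin m × Fin n → Fin k) : Prop :=
  ∃ e : Choices, e.Valid m n k ∧
    (∀ v, e.total (f v) ≤ e.rank m n v.1 v.2 ∧ e.rank m n v.1 v.2 < e.total (f v + 1)) ∧
    (∀ u v, u.1 < e.top e.strips → e.top e.strips ≤ v.1 → f u = f v → e.topToBottom v.2 = true)

end Striping

/-! Every execution visits the cells in one order: `rank` is a bijection onto `0, ..., mn - 1`, and
the parts are consecutive intervals of ranks with the chosen lengths. So balance is automatic, and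
an edge is cut exactly when a break between two parts falls between the ranks of its ends.

Lower bound (`two_mul_le_cutSize`). A part with s ≤ (a+1)² cells that meets p rows and q columns has
s ≤ pq, hence 2s ≤ (a+1)(p+q). A row that meets c parts contains at least c-1 horizontal cut edges,
and similarly for columns. Summing over the parts gives 2mn ≤ (a+1)(cut + m + n) for every balanced
partition, contiguous or not.

Upper bound (`Collects.card_mul_le`). Among edges whose ends differ in rank by at most D, with
distinct earlier ends, at most D are cut by a given break, and breaks are at least A apart. In the
strips of S₁, D is at most a+1 for horizontal edges and 1 for vertical ones. Together with the at
most mn/a edges along the strip borders they give about 2mn/a cut edges. The rows of R have length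
at most 3a and S₂ has height at most 2a, so everything else is O(m + n + a). The two bounds agree to
first order, whence the limit. For a ≥ 4 and m, n ≥ 3a the explicit constants give 61/4; for a = 3
the total number of edges is a good enough upper bound.

Contiguity (`Greedy.tidy`, `Collects.connected_mid`). From each strip as many parts as possible are
cut off. A row of R is then shorter than a part, so only the passage from one row to the next can
disconnect a part. R is flush with the right side, and within a strip the rows grow downwards by at
most one. A row is traversed to the left unless the part that begins in it would then miss the next
row. That can happen only in the last row of a strip, and there traversal to the right is harmless,
because the row above is almost as long. For a ≤ 3, where rows may be very short, sorting the strips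
by the number of cells left settles the remaining cases. -/

namespace Striping

open Finset

/-! ### Connectivity of layered vertex sets -/

/-- A nonempty set of vertices with injective coordinates `p`, `q` is connected if its layers
`p = const` are intervals and every layer but the first is adjacent to the layer before. -/
theorem layered_connected {V : Type*} {G : SimpleGraph V} {S : Set V} (p q : V → ℕ)
    (hinj : ∀ u ∈ S, ∀ v ∈ S, p u = p v → q u = q v → u = v)
    (hq : ∀ u ∈ S, ∀ v ∈ S, p u = p v → q v = q u + 1 → G.Adj u v)
    (hp : ∀ u ∈ S, ∀ v ∈ S, q u = q v → p v = p u + 1 → G.Adj u v)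
    (hint : ∀ u ∈ S, ∀ v ∈ S, p u = p v → ∀ y, q u ≤ y → y ≤ q v →
      ∃ w ∈ S, p w = p u ∧ q w = y)
    (hstep : ∀ u ∈ S, ∀ v ∈ S, p u < p v →
      ∃ u' ∈ S, ∃ v' ∈ S, p u' + 1 = p v ∧ p v' = p v ∧ q u' = q v')
    (hne : S.Nonempty) : (G.induce S).Connected := by
  have row : ∀ d : ℕ, ∀ u v : S, p u.1 = p v.1 → q v.1 = q u.1 + d →
      (G.induce S).Reachable u v := by
    intro d
    induction d with
    | zero =>
      intro u v h1 h2
      have : u = v := Subtype.ext (hinj _ u.2 _ v.2 h1 (by omega))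
      rw [this]
    | succ d ih =>
      intro u v h1 h2
      obtain ⟨w, hw, hw1, hw2⟩ := hint u.1 u.2 v.1 v.2 h1 (q u.1 + d) (by omega) (by omega)
      refine (ih u ⟨w, hw⟩ hw1.symm hw2).trans (SimpleGraph.Adj.reachable ?_)
      exact hq w hw v.1 v.2 (hw1.trans h1) (by omega)
  have row' : ∀ u v : S, p u.1 = p v.1 → (G.induce S).Reachable u v := by
    intro u v h
    rcases le_total (q u.1) (q v.1) with h' | h'
    · exact row (q v.1 - q u.1) u v h (by omega)
    · exact (row (q u.1 - q v.1) v u h.symm (by omega)).symm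
  -- A base point in the first layer; each later layer is reached from the one before it.
  obtain ⟨o, ho, hmin⟩ : ∃ o ∈ S, ∀ v ∈ S, p o ≤ p v := by
    classical
    have hex : ∃ x, ∃ v ∈ S, p v = x := by
      obtain ⟨v, hv⟩ := hne
      exact ⟨_, v, hv, rfl⟩
    obtain ⟨o, ho, hox⟩ := Nat.find_spec hex
    exact ⟨o, ho, fun v hv => hox ▸ Nat.find_min' hex ⟨v, hv, rfl⟩⟩
  have main : ∀ x : ℕ, ∀ v : S, p v.1 = x → (G.induce S).Reachable ⟨o, ho⟩ v := by
    intro x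
    induction x with
    | zero =>
      intro v hv
      have := hmin v.1 v.2
      exact row' _ _ (by simp only; omega)
    | succ x ih =>
      intro v hv
      rcases (hmin v.1 v.2).eq_or_lt with h | h
      · exact row' _ _ h
      · obtain ⟨u', hu', v', hv', h1, h2, h3⟩ := hstep o ho v.1 v.2 h
        have r1 := ih ⟨u', hu'⟩ (by simp only; omega)
        have r2 : (G.induce S).Reachable ⟨u', hu'⟩ ⟨v', hv'⟩ :=
          SimpleGraph.Adj.reachable (hp u' hu' v' hv' h3 (by omega))
        exact (r1.trans r2).trans (row' _ _ h2)
  have : Nonempty S := ⟨⟨o, ho⟩⟩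
  exact ⟨fun u v => (main _ u rfl).symm.trans (main _ v rfl)⟩

theorem eq_of_mul_add_eq {h x y x' y' : ℕ} (hy : y < h) (hy' : y' < h)
    (e : x * h + y = x' * h + y') : x = x' ∧ y = y' := by
  have hh : 0 < h := by omega
  have h1 : (x * h + y) / h = x := by
    rw [mul_comm, Nat.mul_add_div hh, Nat.div_eq_of_lt hy, add_zero]
  have h2 : (x' * h + y') / h = x' := by
    rw [mul_comm, Nat.mul_add_div hh, Nat.div_eq_of_lt hy', add_zero]
  have h3 : x = x' := by rw [← h1, ← h2, e]
  subst h3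
  exact ⟨rfl, by omega⟩

/-- Consecutive positions in layer-by-layer order of a region with layers of length `h` form a
connected set, if there are more than `h` of them. -/
theorem consecutive_connected {V : Type*} {G : SimpleGraph V} (reg : V → Prop) (p q : V → ℕ)
    (h N T s : ℕ)
    (hinj : ∀ u v, reg u → reg v → p u = p v → q u = q v → u = v)
    (hq : ∀ u v, reg u → reg v → p u = p v → q v = q u + 1 → G.Adj u v)
    (hp : ∀ u v, reg u → reg v → q u = q v → p v = p u + 1 → G.Adj u v)
    (hreg : ∀ v, reg v → q v < h)
    (hex : ∀ x y, x < N → y < h → ∃ v, reg v ∧ p v = x ∧ q v = y)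
    (hs : h + 1 ≤ s ∨ h = 1) (hs0 : 0 < s) (hh : 0 < h) (hTs : T + s ≤ N * h) :
    (G.induce {v | reg v ∧ T ≤ p v * h + q v ∧ p v * h + q v < T + s}).Connected := by
  have cell : ∀ r, r < N * h → ∃ v, reg v ∧ p v = r / h ∧ q v = r % h ∧ p v * h + q v = r := by
    intro r hr
    obtain ⟨v, h1, h2, h3⟩ := hex (r / h) (r % h) (Nat.div_lt_of_lt_mul (by rwa [mul_comm]))
      (Nat.mod_lt _ hh)
    exact ⟨v, h1, h2, h3, by rw [h2, h3, mul_comm]; exact Nat.div_add_mod r h⟩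
  refine layered_connected p q (fun u hu v hv => hinj u v hu.1 hv.1)
    (fun u hu v hv => hq u v hu.1 hv.1) (fun u hu v hv => hp u v hu.1 hv.1) ?_ ?_ ?_
  · rintro u ⟨hu, hu1, hu2⟩ v ⟨hv, hv1, hv2⟩ huv y hy1 hy2
    have hyh : y < h := lt_of_le_of_lt hy2 (hreg v hv)
    rw [huv] at hu1 hu2
    obtain ⟨w, hw1, hw2, hw3, hw4⟩ := cell (p v * h + y) (by omega)
    have := hreg w hw1
    obtain ⟨e1, e2⟩ := eq_of_mul_add_eq this hyh hw4
    refine ⟨w, ⟨hw1, ?_, ?_⟩, by rw [e1, huv], e2⟩ <;> rw [hw4] <;> omega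
  · rintro u ⟨hu, hu1, hu2⟩ v ⟨hv, hv1, hv2⟩ huv
    have hle : (p u + 1) * h ≤ p v * h := Nat.mul_le_mul_right h huv
    have hqu := hreg u hu
    have hqv := hreg v hv
    have e1 : (p u + 1) * h = p u * h + h := by ring
    have hpv : 1 ≤ p v := by omega
    have e2 : (p v - 1) * h + h = p v * h := by
      have : (p v - 1 + 1) * h = p v * h := by rw [Nat.sub_add_cancel hpv]
      rw [← this]; ring
    -- The positions `r` and `r + h` face each other in the layers `p v - 1` and `p v`, and `r` is
    -- the first position of the window in the former. If `r` starts its layer, `r + h` is not after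
    -- `v`; if `r = T`, then `r + h` stays in the window because `h < s`. With `s = h` this could
    -- fail, except for `h = 1`.
    set r := max T ((p v - 1) * h) with hr
    have hr1 : T ≤ r := le_max_left _ _
    have hr2 : (p v - 1) * h ≤ r := le_max_right _ _
    have hr3 : r = T ∨ r = (p v - 1) * h := max_choice _ _
    have hTlt : T < p v * h := by omega
    have hrlt : r < p v * h := by omega
    have hrs : r + h < T + s := by
      rcases hs with hs | hs
      · rcases hr3 with e | e <;> omega
      · subst hs
        rcases hr3 with e | e <;> omega
    obtain ⟨u', a1, -, -, a4⟩ := cell r (by omega)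
    obtain ⟨v', b1, -, -, b4⟩ := cell (r + h) (by omega)
    have qa := hreg u' a1
    have qb := hreg v' b1
    obtain ⟨c1, c2⟩ := eq_of_mul_add_eq (x := p u') (y := q u') (x' := p v - 1)
      (y' := r - (p v - 1) * h) qa (by omega) (by omega)
    obtain ⟨d1, d2⟩ := eq_of_mul_add_eq (x := p v') (y := q v') (x' := p v)
      (y' := r - (p v - 1) * h) qb (by omega) (by omega)
    exact ⟨u', ⟨a1, by omega, by omega⟩, v', ⟨b1, by omega, by omega⟩, by omega, by omega,
      by omega⟩
  · obtain ⟨v, h1, h2, h3, h4⟩ := cell T (by omega)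
    exact ⟨v, h1, by omega, by omega⟩

theorem grid_adj_right {m n : ℕ} (u v : Fin m × Fin n) (h1 : u.1.val = v.1.val)
    (h2 : v.2.val = u.2.val + 1) : (grid m n).Adj u v := by
  rw [SimpleGraph.boxProd_adj]
  exact Or.inr ⟨by rw [SimpleGraph.pathGraph_adj]; omega, Fin.ext h1⟩

theorem grid_adj_down {m n : ℕ} (u v : Fin m × Fin n) (h1 : u.2.val = v.2.val)
    (h2 : v.1.val = u.1.val + 1) : (grid m n).Adj u v := by
  rw [SimpleGraph.boxProd_adj]
  exact Or.inl ⟨by rw [SimpleGraph.pathGraph_adj]; omega, Fin.ext h1⟩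

/-! ### Horizontal and vertical cut edges -/

/-- The label of the cell `(x, y)` as a natural number. -/
def label {m n k : ℕ} (f : Fin m × Fin n → Fin k) (x y : ℕ) : ℕ :=
  if h : x < m ∧ y < n then (f (⟨x, h.1⟩, ⟨y, h.2⟩) : ℕ) else 0

theorem label_coe {m n k : ℕ} (f : Fin m × Fin n → Fin k) (v : Fin m × Fin n) :
    label f v.1 v.2 = f v := by
  simp [label]

/-- Left ends of the horizontal cut edges. -/
def hCuts {m n k : ℕ} (f : Fin m × Fin n → Fin k) : Finset (ℕ × ℕ) :=
  (range m ×ˢ range n).filter fun p => p.2 + 1 < n ∧ label f p.1 p.2 ≠ label f p.1 (p.2 + 1)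

/-- Upper ends of the vertical cut edges. -/
def vCuts {m n k : ℕ} (f : Fin m × Fin n → Fin k) : Finset (ℕ × ℕ) :=
  (range m ×ˢ range n).filter fun p => p.1 + 1 < m ∧ label f p.1 p.2 ≠ label f (p.1 + 1) p.2

theorem cutSize_eq {m n k : ℕ} (f : Fin m × Fin n → Fin k) :
    cutSize f = #(hCuts f) + #(vCuts f) := by
  classical
  -- Each cut edge is oriented to the right or downwards, so it is represented by exactly one
  -- ordered pair.
  set DH : Finset ((Fin m × Fin n) × (Fin m × Fin n)) := univ.filter fun p =>
    (p.1.1.val = p.2.1.val ∧ p.2.2.val = p.1.2.val + 1) ∧ f p.1 ≠ f p.2 with hDH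
  set DV : Finset ((Fin m × Fin n) × (Fin m × Fin n)) := univ.filter fun p =>
    (p.1.2.val = p.2.2.val ∧ p.2.1.val = p.1.1.val + 1) ∧ f p.1 ≠ f p.2 with hDV
  have hH : #DH = #(hCuts f) := by
    refine Finset.card_bij (fun p _ => (p.1.1.val, p.1.2.val)) ?_ ?_ ?_
    · rintro ⟨u, v⟩ hp
      simp only [hDH, mem_filter, mem_univ, true_and] at hp
      obtain ⟨⟨h1, h2⟩, h3⟩ := hp
      simp only [hCuts, mem_filter, mem_product, mem_range]
      refine ⟨⟨u.1.2, u.2.2⟩, by have := v.2.2; omega, ?_⟩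
      rw [label_coe, ← h2, h1, label_coe]
      exact fun h => h3 (Fin.ext h)
    · rintro ⟨u, v⟩ hp ⟨u', v'⟩ hp' e
      simp only [hDH, mem_filter, mem_univ, true_and] at hp hp'
      simp only [Prod.mk.injEq] at e
      refine Prod.ext (Prod.ext (Fin.ext e.1) (Fin.ext e.2))
        (Prod.ext (Fin.ext ?_) (Fin.ext ?_)) <;> simp only <;> omega
    · rintro ⟨x, y⟩ hp
      simp only [hCuts, mem_filter, mem_product, mem_range] at hp
      obtain ⟨⟨hx, hy⟩, hy', hne⟩ := hp
      refine ⟨((⟨x, hx⟩, ⟨y, hy⟩), (⟨x, hx⟩, ⟨y + 1, hy'⟩)), ?_, rfl⟩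
      simp only [hDH, mem_filter, mem_univ, true_and]
      refine fun h => hne ?_
      have h1 := label_coe f (⟨x, hx⟩, ⟨y, hy⟩)
      have h2 := label_coe f (⟨x, hx⟩, ⟨y + 1, hy'⟩)
      simp only at h1 h2
      rw [h1, h2, h]
  have hV : #DV = #(vCuts f) := by
    refine Finset.card_bij (fun p _ => (p.1.1.val, p.1.2.val)) ?_ ?_ ?_
    · rintro ⟨u, v⟩ hp
      simp only [hDV, mem_filter, mem_univ, true_and] at hp
      obtain ⟨⟨h1, h2⟩, h3⟩ := hp
      simp only [vCuts, mem_filter, mem_product, mem_range]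
      refine ⟨⟨u.1.2, u.2.2⟩, by have := v.1.2; omega, ?_⟩
      rw [label_coe, ← h2, h1, label_coe]
      exact fun h => h3 (Fin.ext h)
    · rintro ⟨u, v⟩ hp ⟨u', v'⟩ hp' e
      simp only [hDV, mem_filter, mem_univ, true_and] at hp hp'
      simp only [Prod.mk.injEq] at e
      refine Prod.ext (Prod.ext (Fin.ext e.1) (Fin.ext e.2))
        (Prod.ext (Fin.ext ?_) (Fin.ext ?_)) <;> simp only <;> omega
    · rintro ⟨x, y⟩ hp
      simp only [vCuts, mem_filter, mem_product, mem_range] at hp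
      obtain ⟨⟨hx, hy⟩, hx', hne⟩ := hp
      refine ⟨((⟨x, hx⟩, ⟨y, hy⟩), (⟨x + 1, hx'⟩, ⟨y, hy⟩)), ?_, rfl⟩
      simp only [hDV, mem_filter, mem_univ, true_and]
      refine fun h => hne ?_
      have h1 := label_coe f (⟨x, hx⟩, ⟨y, hy⟩)
      have h2 := label_coe f (⟨x + 1, hx'⟩, ⟨y, hy⟩)
      simp only at h1 h2
      rw [h1, h2, h]
  have hdisj : Disjoint DH DV := by
    rw [Finset.disjoint_left]
    rintro ⟨u, v⟩ h1 h2
    simp only [hDH, hDV, mem_filter, mem_univ, true_and] at h1 h2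
    omega
  have himage : {e ∈ (grid m n).edgeSet | ¬ (e.map f).IsDiag} =
      ((DH ∪ DV).image (fun p => s(p.1, p.2)) : Finset (Sym2 (Fin m × Fin n))) := by
    ext e
    induction e using Sym2.ind with
    | _ u v =>
      simp only [Set.mem_sep_iff, SimpleGraph.mem_edgeSet, Sym2.map_mk, Sym2.mk_isDiag_iff,
        coe_image, Set.mem_image, mem_coe, mem_union, hDH, hDV, mem_filter, mem_univ, true_and]
      constructor
      · rintro ⟨hadj, hne⟩
        rw [SimpleGraph.boxProd_adj, SimpleGraph.pathGraph_adj, SimpleGraph.pathGraph_adj] at hadj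
        rcases hadj with ⟨h1 | h1, h2⟩ | ⟨h1 | h1, h2⟩
        · exact ⟨(u, v), Or.inr ⟨⟨congrArg Fin.val h2, h1.symm⟩, hne⟩, rfl⟩
        · exact ⟨(v, u), Or.inr ⟨⟨congrArg Fin.val h2.symm, h1.symm⟩, Ne.symm hne⟩, Sym2.eq_swap⟩
        · exact ⟨(u, v), Or.inl ⟨⟨congrArg Fin.val h2, h1.symm⟩, hne⟩, rfl⟩
        · exact ⟨(v, u), Or.inl ⟨⟨congrArg Fin.val h2.symm, h1.symm⟩, Ne.symm hne⟩, Sym2.eq_swap⟩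
      · rintro ⟨⟨u', v'⟩, h, e⟩
        have key : (grid m n).Adj u' v' ∧ f u' ≠ f v' := by
          rcases h with ⟨⟨h1, h2⟩, h3⟩ | ⟨⟨h1, h2⟩, h3⟩
          · exact ⟨grid_adj_right _ _ h1 h2, h3⟩
          · exact ⟨grid_adj_down _ _ h1 h2, h3⟩
        rcases Sym2.eq_iff.1 e with ⟨e1, e2⟩ | ⟨e1, e2⟩
        · subst e1 e2; exact key
        · subst e1 e2; exact ⟨key.1.symm, key.2.symm⟩
  rw [cutSize, himage, Set.ncard_coe_finset, Finset.card_image_of_injOn, card_union_of_disjoint hdisj,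
    hH, hV]
  rintro ⟨u, v⟩ h1 ⟨u', v'⟩ h2 e
  simp only [coe_union, Set.mem_union, mem_coe, hDH, hDV, mem_filter, mem_univ, true_and] at h1 h2
  rcases Sym2.eq_iff.1 e with ⟨e1, e2⟩ | ⟨e1, e2⟩
  · simp only at e1 e2; rw [e1, e2]
  · simp only at e1 e2
    subst e1 e2
    exfalso; omega

/-! ### The lower bound -/

/-- Every value except the first makes its first appearance at a change. This bounds the number of
parts that meet a row or a column. -/
theorem card_image_range_le {g : ℕ → ℕ} (n : ℕ) :
    #((range n).image g) ≤ 1 + #((range n).filter fun y => y + 1 < n ∧ g y ≠ g (y + 1)) := by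
  induction n with
  | zero => simp
  | succ n ih =>
    rcases Nat.eq_zero_or_pos n with rfl | hn
    · simp
    have hsub : (range n).filter (fun y => y + 1 < n ∧ g y ≠ g (y + 1)) ⊆
        (range (n + 1)).filter (fun y => y + 1 < n + 1 ∧ g y ≠ g (y + 1)) := by
      intro y
      simp only [mem_filter, mem_range]
      rintro ⟨h1, h2, h3⟩
      exact ⟨by omega, by omega, h3⟩
    rw [range_add_one, image_insert]
    by_cases h : g (n - 1) = g n
    · have : g n ∈ (range n).image g := mem_image.2 ⟨n - 1, by simp; omega, h⟩
      rw [insert_eq_of_mem this, ← range_add_one]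
      exact ih.trans (Nat.add_le_add_left (card_le_card hsub) 1)
    · refine (card_insert_le _ _).trans ?_
      rw [← range_add_one]
      have hlt : #((range n).filter (fun y => y + 1 < n ∧ g y ≠ g (y + 1))) <
          #((range (n + 1)).filter (fun y => y + 1 < n + 1 ∧ g y ≠ g (y + 1))) := by
        refine card_lt_card ⟨hsub, fun hs => ?_⟩
        have h1 : n - 1 ∈ (range (n + 1)).filter (fun y => y + 1 < n + 1 ∧ g y ≠ g (y + 1)) := by
          simp only [mem_filter, mem_range]
          refine ⟨by omega, by omega, ?_⟩
          rwa [Nat.sub_add_cancel hn]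
        have h2 := hs h1
        simp only [mem_filter, mem_range] at h2
        omega
      omega

/-- The isoperimetric inequality behind the lower bound. -/
theorem two_mul_le_mul_add {b p q s : ℕ} (h : s ≤ p * q) (hs : s ≤ b ^ 2) :
    2 * s ≤ b * (p + q) := by
  by_contra hlt
  push Not at hlt
  -- By the inequality of the means, s² ≤ b² · pq ≤ b² (p+q)² / 4.
  have h1 : (b * (p + q)) ^ 2 < (2 * s) ^ 2 := Nat.pow_lt_pow_left hlt (by norm_num)
  have h2 : 4 * (p * q) ≤ (p + q) ^ 2 := by
    zify; nlinarith [sq_nonneg ((p : ℤ) - q)]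
  have h3 : (2 * s) ^ 2 ≤ (b * (p + q)) ^ 2 := by
    calc (2 * s) ^ 2 = s * (4 * s) := by ring
      _ ≤ b ^ 2 * (4 * (p * q)) := Nat.mul_le_mul hs (Nat.mul_le_mul_left 4 h)
      _ ≤ b ^ 2 * (p + q) ^ 2 := Nat.mul_le_mul_left _ h2
      _ = _ := by ring
  omega

/-- Double counting of the pairs (part, row) and (part, column) that meet: by parts there are many
of them, by isoperimetry; by rows and columns there are at most `m + n` plus the number of cut
edges. -/
theorem two_mul_le_cutSize {m n k b : ℕ} (f : Fin m × Fin n → Fin k)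
    (hb : ∀ i, {v | f v = i}.ncard ≤ b ^ 2) :
    2 * (m * n) ≤ b * (cutSize f + m + n) := by
  classical
  set F := label f with hF
  have hFk : ∀ p ∈ range m ×ˢ range n, F p.1 p.2 ∈ range k := by
    rintro ⟨x, y⟩ hp
    simp only [mem_product, mem_range] at hp
    have := label_coe f (⟨x, hp.1⟩, ⟨y, hp.2⟩)
    simp only at this
    rw [hF, this, mem_range]
    exact (f _).2
  set cells : ℕ → Finset (ℕ × ℕ) := fun i => (range m ×ˢ range n).filter fun p => F p.1 p.2 = i
  set rows : ℕ → Finset ℕ := fun i => (range m).filter fun x => i ∈ (range n).image (F x)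
  set cols : ℕ → Finset ℕ := fun i => (range n).filter fun y => i ∈ (range m).image (fun x => F x y)
  have hcells : ∀ i < k, #(cells i) ≤ b ^ 2 := by
    intro i hi
    refine le_trans (le_of_eq ?_) (hb ⟨i, hi⟩)
    rw [Set.ncard_eq_toFinset_card']
    symm
    refine Finset.card_bij (fun v _ => (v.1.val, v.2.val)) ?_ ?_ ?_
    · intro v hv
      simp only [Set.mem_toFinset, Set.mem_ofPred_eq] at hv
      simp only [cells, mem_filter, mem_product, mem_range]
      exact ⟨⟨v.1.2, v.2.2⟩, by rw [hF, label_coe, hv]⟩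
    · intro u _ v _ e
      simp only [Prod.mk.injEq] at e
      exact Prod.ext (Fin.ext e.1) (Fin.ext e.2)
    · rintro ⟨x, y⟩ hp
      simp only [cells, mem_filter, mem_product, mem_range] at hp
      refine ⟨(⟨x, hp.1.1⟩, ⟨y, hp.1.2⟩), ?_, rfl⟩
      simp only [Set.mem_toFinset, Set.mem_ofPred_eq]
      apply Fin.ext
      rw [← label_coe f]
      exact hp.2
  have hsub : ∀ i, cells i ⊆ rows i ×ˢ cols i := by
    rintro i ⟨x, y⟩ hp
    simp only [cells, mem_filter, mem_product, mem_range] at hp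
    simp only [rows, cols, mem_product, mem_filter, mem_range, mem_image]
    exact ⟨⟨hp.1.1, y, hp.1.2, hp.2⟩, hp.1.2, x, hp.1.1, hp.2⟩
  have hpart : ∀ i < k, 2 * #(cells i) ≤ b * (#(rows i) + #(cols i)) := by
    intro i hi
    refine two_mul_le_mul_add ?_ (hcells i hi)
    rw [← card_product]
    exact card_le_card (hsub i)
  have htotal : ∑ i ∈ range k, #(cells i) = m * n := by
    have := Finset.card_eq_sum_card_fiberwise hFk
    rw [card_product, card_range, card_range] at this
    exact this.symm
  have hrows : ∑ i ∈ range k, #(rows i) ≤ m + #(hCuts f) := by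
    have e1 : ∑ i ∈ range k, #(rows i) ≤
        ∑ x ∈ range m, (1 + #((range n).filter fun y => y + 1 < n ∧ F x y ≠ F x (y + 1))) := by
      have e0 : ∑ i ∈ range k, #(rows i) =
          ∑ x ∈ range m, #((range k).filter fun i => i ∈ (range n).image (F x)) := by
        simp only [rows, card_filter]
        rw [sum_comm]
      rw [e0]
      refine sum_le_sum fun x _ => ?_
      refine le_trans (card_le_card ?_) (card_image_range_le (g := F x) n)
      intro i hi
      exact (mem_filter.1 hi).2
    refine e1.trans (le_of_eq ?_)
    rw [sum_add_distrib, sum_const, card_range, smul_eq_mul, mul_one, hCuts]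
    congr 1
    simp only [card_filter, sum_product]
    rfl
  have hcols : ∑ i ∈ range k, #(cols i) ≤ n + #(vCuts f) := by
    have e1 : ∑ i ∈ range k, #(cols i) ≤
        ∑ y ∈ range n, (1 + #((range m).filter fun x => x + 1 < m ∧ F x y ≠ F (x + 1) y)) := by
      have e0 : ∑ i ∈ range k, #(cols i) =
          ∑ y ∈ range n, #((range k).filter fun i => i ∈ (range m).image (fun x => F x y)) := by
        simp only [cols, card_filter]
        rw [sum_comm]
      rw [e0]
      refine sum_le_sum fun y _ => ?_
      refine le_trans (card_le_card ?_) (card_image_range_le (g := fun x => F x y) m)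
      intro i hi
      exact (mem_filter.1 hi).2
    refine e1.trans (le_of_eq ?_)
    rw [sum_add_distrib, sum_const, card_range, smul_eq_mul, mul_one, vCuts]
    congr 1
    simp only [card_filter, sum_product]
    rw [sum_comm]
  calc 2 * (m * n) = ∑ i ∈ range k, 2 * #(cells i) := by rw [← mul_sum, htotal]
    _ ≤ ∑ i ∈ range k, b * (#(rows i) + #(cols i)) :=
        sum_le_sum fun i hi => hpart i (mem_range.1 hi)
    _ = b * (∑ i ∈ range k, #(rows i) + ∑ i ∈ range k, #(cols i)) := by
        rw [← mul_sum, sum_add_distrib]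
    _ ≤ b * (cutSize f + m + n) := by
        refine Nat.mul_le_mul_left b ?_
        rw [cutSize_eq]; omega

theorem cutSize_le_two_mul {m n k : ℕ} (f : Fin m × Fin n → Fin k) :
    cutSize f ≤ 2 * (m * n) := by
  have h1 : #(hCuts f) ≤ m * n := (card_filter_le _ _).trans (by simp)
  have h2 : #(vCuts f) ≤ m * n := (card_filter_le _ _).trans (by simp)
  rw [cutSize_eq]; omega

theorem side_pos {m n k : ℕ} (hk : 0 < k) (hkmn : k ≤ m * n) : 0 < side m n k := by
  rw [side, Nat.sqrt_pos]
  exact Nat.div_pos hkmn hk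

theorem sq_side_le (m n k : ℕ) : side m n k * side m n k ≤ partSize m n k := Nat.sqrt_le _

theorem partSize_lt (m n k : ℕ) : partSize m n k < (side m n k + 1) * (side m n k + 1) :=
  Nat.lt_succ_sqrt _

/-- If a strip of height `h` has `N` cells left, its row at depth `d` has `(N + d) / h` of them. In
the induction the summands shift by one, and `N / h` gives way to `(N + h) / h`. -/
theorem sum_range_add_div (h N : ℕ) (hh : 0 < h) : ∑ d ∈ range h, (N + d) / h = N := by
  induction N with
  | zero =>
    refine sum_eq_zero fun d hd => ?_
    rw [zero_add]
    exact Nat.div_eq_of_lt (mem_range.1 hd)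
  | succ N ih =>
    have e1 := sum_range_succ (fun d => (N + d) / h) h
    have e2 := sum_range_succ' (fun d => (N + d) / h) h
    have e3 : (N + h) / h = N / h + 1 := Nat.add_div_right N hh
    have e4 : ∑ d ∈ range h, (N + 1 + d) / h = ∑ d ∈ range h, (N + (d + 1)) / h :=
      sum_congr rfl fun d _ => by congr 1; ring
    rw [add_zero] at e2
    omega

theorem exists_le_lt_succ {g : ℕ → ℕ} {N x : ℕ} (h0 : g 0 ≤ x) (hx : x < g N) :
    ∃ i < N, g i ≤ x ∧ x < g (i + 1) := by
  have hP : ∃ i, x < g i := ⟨_, hx⟩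
  have h1 := Nat.find_spec hP
  have h2 : Nat.find hP ≤ N := Nat.find_min' hP hx
  have h0 : Nat.find hP ≠ 0 := by
    intro h
    rw [h] at h1
    omega
  have h3 := Nat.find_min hP (m := Nat.find hP - 1) (by omega)
  exact ⟨Nat.find hP - 1, by omega, by omega, by rwa [Nat.sub_add_cancel (by omega)]⟩

/-! ### The order of visit as a bijection -/

namespace Choices

variable {e : Choices} {m n k : ℕ}

/-- The number of vertices of row `x` in the region `R`. -/
def width (e : Choices) (n x : ℕ) : ℕ := n - e.leftEnd n x

/-- The rank of the first vertex of row `x` in the region `R`. -/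
def base (e : Choices) (n x : ℕ) : ℕ :=
  e.total (e.start e.strips) + ∑ z ∈ range x, (n - e.leftEnd n z)

theorem top_succ (e : Choices) (i : ℕ) : e.top (i + 1) = e.top i + e.height i :=
  sum_range_succ _ _

theorem start_succ (e : Choices) (i : ℕ) : e.start (i + 1) = e.start i + e.count i :=
  sum_range_succ _ _

theorem total_succ (e : Choices) (t : ℕ) : e.total (t + 1) = e.total t + e.size t :=
  sum_range_succ _ _

theorem base_succ (e : Choices) (n x : ℕ) : e.base n (x + 1) = e.base n x + e.width n x := by
  rw [base, base, sum_range_succ, width]; ring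

theorem top_mono (e : Choices) : Monotone e.top :=
  monotone_nat_of_le_succ fun i => by rw [top_succ]; omega

theorem start_mono (e : Choices) : Monotone e.start :=
  monotone_nat_of_le_succ fun i => by rw [start_succ]; omega

theorem total_mono (e : Choices) : Monotone e.total :=
  monotone_nat_of_le_succ fun i => by rw [total_succ]; omega

theorem base_mono (e : Choices) (n : ℕ) : Monotone (e.base n) :=
  monotone_nat_of_le_succ fun i => by rw [base_succ]; omega

theorem base_zero (e : Choices) (n : ℕ) : e.base n 0 = e.total (e.start e.strips) := by
  simp [base]

theorem total_start_succ (e : Choices) (i : ℕ) :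
    e.total (e.start (i + 1)) = e.total (e.start i) + e.used i := by
  rw [total, total, used, range_eq_Ico, range_eq_Ico]
  exact (sum_Ico_consecutive _ (Nat.zero_le _) (e.start_mono (Nat.le_succ i))).symm

theorem stripOf_eq {i x : ℕ} (hi : i < e.strips) (h1 : e.top i ≤ x) (h2 : x < e.top (i + 1)) :
    e.stripOf x = i := by
  have : (range e.strips).filter (fun i => e.top (i + 1) ≤ x) = range i := by
    ext j
    simp only [mem_filter, mem_range]
    constructor
    · rintro ⟨-, hj⟩
      by_contra hij
      have := e.top_mono (show i + 1 ≤ j + 1 by omega)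
      omega
    · intro hj
      have := e.top_mono (show j + 1 ≤ i by omega)
      exact ⟨by omega, by omega⟩
  rw [stripOf, this, card_range]

theorem exists_strip {x : ℕ} (hx : x < e.top e.strips) :
    ∃ i < e.strips, e.top i ≤ x ∧ x < e.top (i + 1) :=
  exists_le_lt_succ (by simp [top]) hx

theorem height_pos (V : e.Valid m n k) (ha : 0 < side m n k) {i : ℕ} (hi : i < e.strips) :
    0 < e.height i := by
  rcases V.height_eq i hi with h | h <;> omega

theorem sub_top_lt {i x : ℕ} (h1 : e.top i ≤ x) (h2 : x < e.top (i + 1)) :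
    x - e.top i < e.height i := by
  rw [top_succ] at h2; omega

theorem lt_used_iff (V : e.Valid m n k) (ha : 0 < side m n k) {i x y : ℕ} (hi : i < e.strips)
    (h1 : e.top i ≤ x) (h2 : x < e.top (i + 1)) (hy : y < n) :
    y * e.height i + (x - e.top i) < e.used i ↔
      y < n - (e.rest n i + (x - e.top i)) / e.height i := by
  have hh := height_pos V ha hi
  have hu := V.used_le i hi
  have hd := sub_top_lt h1 h2
  rw [rest]
  set h := e.height i
  set d := x - e.top i
  set u := e.used i
  have key : (h * n - u + d) / h < n - y ↔ h * n - u + d < (n - y) * h :=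
    Nat.div_lt_iff_lt_mul hh
  have e1 : (n - y) * h + y * h = h * n := by
    rw [← add_mul, Nat.sub_add_cancel hy.le, mul_comm]
  omega

theorem leftEnd_eq (V : e.Valid m n k) (ha : 0 < side m n k) {i x : ℕ} (hi : i < e.strips)
    (h1 : e.top i ≤ x) (h2 : x < e.top (i + 1)) :
    e.leftEnd n x = n - (e.rest n i + (x - e.top i)) / e.height i := by
  rw [leftEnd]
  have : (range n).filter (fun y => e.pos x y < e.used (e.stripOf x)) =
      range (n - (e.rest n i + (x - e.top i)) / e.height i) := by
    ext y
    simp only [mem_filter, mem_range, pos, stripOf_eq hi h1 h2]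
    constructor
    · rintro ⟨hy, h⟩
      exact (lt_used_iff V ha hi h1 h2 hy).1 h
    · intro h
      have hy : y < n := h.trans_le (Nat.sub_le _ _)
      exact ⟨hy, (lt_used_iff V ha hi h1 h2 hy).2 h⟩
  rw [this, card_range]

/-- The cells left in a strip are the last ones column by column: complete columns on the right and
the lower end of one more column. -/
theorem width_eq (V : e.Valid m n k) (ha : 0 < side m n k) {i x : ℕ} (hi : i < e.strips)
    (h1 : e.top i ≤ x) (h2 : x < e.top (i + 1)) :
    e.width n x = (e.rest n i + (x - e.top i)) / e.height i := by
  have hh := height_pos V ha hi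
  have hd := sub_top_lt h1 h2
  rw [width, leftEnd_eq V ha hi h1 h2]
  have : (e.rest n i + (x - e.top i)) / e.height i < n + 1 := by
    rw [Nat.div_lt_iff_lt_mul hh, rest]
    have : (n + 1) * e.height i = e.height i * n + e.height i := by ring
    omega
  exact Nat.sub_sub_self (Nat.lt_succ_iff.1 this)

theorem pos_lt_used_iff (V : e.Valid m n k) (ha : 0 < side m n k) {i x y : ℕ} (hi : i < e.strips)
    (h1 : e.top i ≤ x) (h2 : x < e.top (i + 1)) (hy : y < n) :
    y * e.height i + (x - e.top i) < e.used i ↔ y < e.leftEnd n x := by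
  rw [leftEnd_eq V ha hi h1 h2]
  exact lt_used_iff V ha hi h1 h2 hy

theorem leftEnd_le (e : Choices) (n x : ℕ) : e.leftEnd n x ≤ n :=
  (card_filter_le _ _).trans (by simp)

theorem base_top_succ (V : e.Valid m n k) (ha : 0 < side m n k) {i : ℕ} (hi : i < e.strips) :
    e.base n (e.top (i + 1)) = e.base n (e.top i) + e.rest n i := by
  rw [base, base, top_succ, sum_range_add, add_assoc]
  congr 2
  rw [← sum_range_add_div (e.height i) (e.rest n i) (height_pos V ha hi)]
  refine sum_congr rfl fun d hd => ?_
  have := width_eq V ha (x := e.top i + d) hi (by omega)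
    (by rw [top_succ]; have := mem_range.1 hd; omega)
  rw [width] at this
  rw [this, Nat.add_sub_cancel_left]

/-- Each cell above strip `i` is either cut off in Step 2 or belongs to R. For `i = e.strips` this
shows that the ranks of Step 4 continue those of Step 3. -/
theorem base_top (V : e.Valid m n k) (ha : 0 < side m n k) :
    ∀ i ≤ e.strips, e.base n (e.top i) + e.total (e.start i) =
      e.total (e.start e.strips) + e.top i * n := by
  intro i
  induction i with
  | zero => intro _; simp [base, top, start, total]
  | succ i ih =>
    intro hi
    have ih := ih (by omega)
    rw [base_top_succ V ha hi, total_start_succ, top_succ, rest, add_mul]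
    have := V.used_le i hi
    omega

theorem base_strips (V : e.Valid m n k) (ha : 0 < side m n k) :
    e.base n (e.top e.strips) = e.top e.strips * n := by
  have := base_top V ha _ le_rfl
  omega

theorem total_k (V : e.Valid m n k) : e.total k = m * n := by
  have h1 : e.total k = ∑ t ∈ range k, (partSize m n k +
      if e.size t = partSize m n k + 1 then 1 else 0) := by
    refine sum_congr rfl fun t ht => ?_
    rcases V.size_eq t (mem_range.1 ht) with h | h <;> simp [h]
  rw [h1, sum_add_distrib, ← card_filter, V.card_large, sum_const, card_range, smul_eq_mul,
    partSize]
  exact Nat.div_add_mod _ _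

/-- Cells that are partitioned in Step 2. -/
theorem rank_left (V : e.Valid m n k) (ha : 0 < side m n k) {i x y : ℕ} (hi : i < e.strips)
    (h1 : e.top i ≤ x) (h2 : x < e.top (i + 1)) (hy : y < n) (hl : y < e.leftEnd n x) :
    e.rank m n x y = e.total (e.start i) + (y * e.height i + (x - e.top i)) := by
  have hx : x < e.top e.strips := h2.trans_le (e.top_mono hi)
  have hp := (pos_lt_used_iff V ha hi h1 h2 hy).2 hl
  rw [rank, if_pos hx, pos, stripOf_eq hi h1 h2, if_pos hp]

/-- Cells of the region `R`. -/
theorem rank_mid (V : e.Valid m n k) (ha : 0 < side m n k) {x y : ℕ} (hx : x < e.top e.strips)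
    (hy : y < n) (hl : e.leftEnd n x ≤ y) :
    e.rank m n x y = e.base n x +
      if e.leftToRight x then y - e.leftEnd n x else n - 1 - y := by
  obtain ⟨i, hi, h1, h2⟩ := exists_strip hx
  have hp := (pos_lt_used_iff V ha hi h1 h2 hy).not.2 (by omega)
  rw [rank, if_pos hx, pos, stripOf_eq hi h1 h2, if_neg hp, base]

/-- Cells of the bottom strip. -/
theorem rank_bottom (V : e.Valid m n k) {x y : ℕ} (hx : e.top e.strips ≤ x) :
    e.rank m n x y = e.top e.strips * n + (n - 1 - y) * bottomHeight m n k +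
      if e.topToBottom y then x - e.top e.strips else m - 1 - x := by
  have := V.height_sum
  rw [rank, if_neg (by omega)]
  congr 3
  omega

theorem rank_left_lt (V : e.Valid m n k) (ha : 0 < side m n k) {x y : ℕ}
    (hx : x < e.top e.strips) (hy : y < n) (hl : y < e.leftEnd n x) :
    e.rank m n x y < e.base n 0 := by
  obtain ⟨i, hi, h1, h2⟩ := exists_strip hx
  have hp := (pos_lt_used_iff V ha hi h1 h2 hy).2 hl
  have h3 := e.total_mono (e.start_mono (show i + 1 ≤ e.strips from hi))
  rw [total_start_succ] at h3
  rw [rank_left V ha hi h1 h2 hy hl, base_zero]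
  omega

theorem rank_mid_mem (V : e.Valid m n k) (ha : 0 < side m n k) {x y : ℕ}
    (hx : x < e.top e.strips) (hy : y < n) (hl : e.leftEnd n x ≤ y) :
    e.base n x ≤ e.rank m n x y ∧ e.rank m n x y < e.base n (x + 1) := by
  rw [rank_mid V ha hx hy hl, base_succ, width]
  have := e.leftEnd_le n x
  split_ifs <;> omega

theorem rank_bottom_mem (V : e.Valid m n k) {x y : ℕ} (hx : e.top e.strips ≤ x) (hxm : x < m)
    (hy : y < n) :
    e.top e.strips * n ≤ e.rank m n x y ∧ e.rank m n x y < m * n := by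
  rw [rank_bottom V hx]
  have h0 := V.height_sum
  set b := bottomHeight m n k
  have h1 : (n - 1 - y) * b + b ≤ n * b := by
    rw [← Nat.succ_mul]; exact Nat.mul_le_mul_right b (by omega)
  have h2 : m * n = e.top e.strips * n + n * b := by rw [← h0]; ring
  split_ifs <;> omega

theorem rank_lt (V : e.Valid m n k) (ha : 0 < side m n k) {x y : ℕ} (hx : x < m) (hy : y < n) :
    e.rank m n x y < m * n := by
  have h0 : e.top e.strips * n ≤ m * n :=
    Nat.mul_le_mul_right n (by have := V.height_sum; omega)
  rw [← base_strips V ha] at h0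
  rcases lt_or_ge x (e.top e.strips) with h | h
  · rcases lt_or_ge y (e.leftEnd n x) with hl | hl
    · exact (rank_left_lt V ha h hy hl).trans_le ((e.base_mono n (Nat.zero_le _)).trans h0)
    · exact (rank_mid_mem V ha h hy hl).2.trans_le ((e.base_mono n h).trans h0)
  · exact (rank_bottom_mem V h hx hy).2

/-- The three steps, the strips in Step 2 and the rows in Step 3 use disjoint ranges of ranks;
inside a strip or S₂ the rank determines column and row as quotient and remainder. -/
theorem rank_inj (V : e.Valid m n k) (ha : 0 < side m n k) {x y x' y' : ℕ} (hx : x < m)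
    (hy : y < n) (hx' : x' < m) (hy' : y' < n) (he : e.rank m n x y = e.rank m n x' y') :
    x = x' ∧ y = y' := by
  have hb0 : e.base n 0 ≤ e.top e.strips * n := by
    rw [← base_strips V ha]; exact e.base_mono n (Nat.zero_le _)
  have hb : ∀ z < e.top e.strips, e.base n (z + 1) ≤ e.top e.strips * n := by
    intro z hz
    rw [← base_strips V ha]; exact e.base_mono n hz
  have h0 := V.height_sum
  rcases lt_or_ge x (e.top e.strips) with h | h
  · rcases lt_or_ge x' (e.top e.strips) with h' | h'
    · rcases lt_or_ge y (e.leftEnd n x) with hl | hl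
      · have r1 := rank_left_lt V ha h hy hl
        rcases lt_or_ge y' (e.leftEnd n x') with hl' | hl'
        · obtain ⟨i, hi, a1, a2⟩ := exists_strip h
          obtain ⟨i', hi', b1, b2⟩ := exists_strip h'
          have p1 := (pos_lt_used_iff V ha hi a1 a2 hy).2 hl
          have p2 := (pos_lt_used_iff V ha hi' b1 b2 hy').2 hl'
          have s1 := e.total_start_succ i
          have s2 := e.total_start_succ i'
          have key : i = i' := by
            rw [rank_left V ha hi a1 a2 hy hl, rank_left V ha hi' b1 b2 hy' hl'] at he
            rcases lt_trichotomy i i' with q | q | q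
            · have := e.total_mono (e.start_mono (show i + 1 ≤ i' from q)); omega
            · exact q
            · have := e.total_mono (e.start_mono (show i' + 1 ≤ i from q)); omega
          subst key
          rw [rank_left V ha hi a1 a2 hy hl, rank_left V ha hi' b1 b2 hy' hl'] at he
          have := eq_of_mul_add_eq (sub_top_lt a1 a2) (sub_top_lt b1 b2)
            (Nat.add_left_cancel he)
          omega
        · have := rank_mid_mem V ha h' hy' hl'
          have := e.base_mono n (Nat.zero_le x')
          omega
      · have r1 := rank_mid_mem V ha h hy hl
        rcases lt_or_ge y' (e.leftEnd n x') with hl' | hl'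
        · have := rank_left_lt V ha h' hy' hl'
          have := e.base_mono n (Nat.zero_le x)
          omega
        · have r2 := rank_mid_mem V ha h' hy' hl'
          have key : x = x' := by
            rcases lt_trichotomy x x' with q | q | q
            · have := e.base_mono n (show x + 1 ≤ x' from q); omega
            · exact q
            · have := e.base_mono n (show x' + 1 ≤ x from q); omega
          subst key
          rw [rank_mid V ha h hy hl, rank_mid V ha h hy' hl'] at he
          refine ⟨rfl, ?_⟩
          split_ifs at he <;> omega
    · have := rank_bottom_mem V h' hx' hy'
      have := hb x h
      rcases lt_or_ge y (e.leftEnd n x) with hl | hl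
      · have := rank_left_lt V ha h hy hl; omega
      · have := rank_mid_mem V ha h hy hl; omega
  · have := rank_bottom_mem V h hx hy
    rcases lt_or_ge x' (e.top e.strips) with h' | h'
    · have := hb x' h'
      rcases lt_or_ge y' (e.leftEnd n x') with hl | hl
      · have := rank_left_lt V ha h' hy' hl; omega
      · have := rank_mid_mem V ha h' hy' hl; omega
    · rw [rank_bottom V h, rank_bottom V h', add_assoc, add_assoc] at he
      have := eq_of_mul_add_eq (h := bottomHeight m n k) (by split_ifs <;> omega)
        (by split_ifs <;> omega) (Nat.add_left_cancel he)
      have hyy : y = y' := by omega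
      subst hyy
      refine ⟨?_, rfl⟩
      have := this.2
      split_ifs at this <;> omega

theorem exists_rank_eq (V : e.Valid m n k) (ha : 0 < side m n k) {r : ℕ} (hr : r < m * n) :
    ∃ v : Fin m × Fin n, e.rank m n v.1 v.2 = r := by
  let g : Fin m × Fin n → Fin (m * n) := fun v => ⟨e.rank m n v.1 v.2, rank_lt V ha v.1.2 v.2.2⟩
  have hg : Function.Injective g := by
    intro u v huv
    have := rank_inj V ha u.1.2 u.2.2 v.1.2 v.2.2 (congrArg Fin.val huv)
    exact Prod.ext (Fin.ext this.1) (Fin.ext this.2)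
  have hb : Function.Bijective g :=
    (Fintype.bijective_iff_injective_and_card g).2 ⟨hg, by simp⟩
  obtain ⟨v, hv⟩ := hb.2 ⟨r, hr⟩
  exact ⟨v, congrArg Fin.val hv⟩

/-- `f` collects the vertices, in the order of their ranks, into parts of the chosen sizes. -/
def Collects (e : Choices) (f : Fin m × Fin n → Fin k) : Prop :=
  ∀ v, e.total (f v) ≤ e.rank m n v.1 v.2 ∧ e.rank m n v.1 v.2 < e.total (f v + 1)

theorem Collects.eq_iff {f : Fin m × Fin n → Fin k} (hf : e.Collects f) (v : Fin m × Fin n)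
    (i : Fin k) :
    f v = i ↔ e.total i ≤ e.rank m n v.1 v.2 ∧ e.rank m n v.1 v.2 < e.total (i + 1) := by
  have h := hf v
  constructor
  · rintro rfl; exact h
  · intro h'
    apply Fin.ext
    rcases lt_trichotomy (f v : ℕ) (i : ℕ) with q | q | q
    · have := e.total_mono (show (f v : ℕ) + 1 ≤ i from q); omega
    · exact q
    · have := e.total_mono (show (i : ℕ) + 1 ≤ f v from q); omega

/-- A part is the preimage of an interval of length `e.size i` under the bijection `rank`. -/
theorem Collects.isBalanced {f : Fin m × Fin n → Fin k} (hf : e.Collects f)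
    (V : e.Valid m n k) (ha : 0 < side m n k) : IsBalanced f := by
  classical
  intro i
  have : {v | f v = i}.ncard = e.size i := by
    rw [Set.ncard_eq_toFinset_card']
    have h1 : #(Finset.Ico (e.total i) (e.total (i + 1))) = e.size i := by
      rw [Nat.card_Ico, total_succ]; omega
    rw [← h1]
    refine Finset.card_bij (fun v _ => e.rank m n v.1 v.2) ?_ ?_ ?_
    · intro v hv
      simp only [Set.mem_toFinset, Set.mem_ofPred_eq] at hv
      exact mem_Ico.2 ((hf.eq_iff v i).1 hv)
    · intro u _ v _ huv
      have := rank_inj V ha u.1.2 u.2.2 v.1.2 v.2.2 huv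
      exact Prod.ext (Fin.ext this.1) (Fin.ext this.2)
    · intro r hr
      have hr := mem_Ico.1 hr
      have := e.total_mono (show (i : ℕ) + 1 ≤ k from i.2)
      rw [total_k V] at this
      obtain ⟨v, hv⟩ := exists_rank_eq V ha (show r < m * n by omega)
      refine ⟨v, ?_, hv⟩
      simp only [Set.mem_toFinset, Set.mem_ofPred_eq]
      exact (hf.eq_iff v i).2 (by omega)
  rw [this]
  exact V.size_eq i i.2

theorem exists_collects (V : e.Valid m n k) (ha : 0 < side m n k) :
    ∃ f : Fin m × Fin n → Fin k, e.Collects f := by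
  have key : ∀ v : Fin m × Fin n, ∃ i : Fin k,
      e.total i ≤ e.rank m n v.1 v.2 ∧ e.rank m n v.1 v.2 < e.total (i + 1) := by
    intro v
    have hlt : e.rank m n v.1 v.2 < e.total k := by
      rw [total_k V]; exact rank_lt V ha v.1.2 v.2.2
    obtain ⟨t, ht, h⟩ := exists_le_lt_succ (by simp [total]) hlt
    exact ⟨⟨t, ht⟩, h⟩
  choose f hf using key
  exact ⟨f, hf⟩

end Choices

/-! ### Counting cut edges by breaks -/

namespace Choices

variable {e : Choices} {m n k : ℕ}

theorem mul_partSize_le_total_sub (V : e.Valid m n k) {s t : ℕ} (hst : s ≤ t) (ht : t ≤ k) :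
    (t - s) * partSize m n k + e.total s ≤ e.total t := by
  induction t, hst using Nat.le_induction with
  | base => simp
  | succ t hst ih =>
    have ih := ih (by omega)
    have h1 : partSize m n k ≤ e.size t := by
      rcases V.size_eq t (by omega) with h | h <;> omega
    have h2 : (t + 1 - s) * partSize m n k = (t - s) * partSize m n k + partSize m n k := by
      rw [Nat.sub_add_comm hst, add_mul, one_mul]
    rw [total_succ]
    omega

/-- Consecutive breaks are at least `A` apart; the extra `A` pays for the first one. -/
theorem card_breaks_mul_le (V : e.Valid m n k) (lo hi : ℕ) :
    #((range k).filter fun t => lo < e.total t ∧ e.total t < hi) * partSize m n k ≤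
      hi - lo + partSize m n k := by
  set T := (range k).filter fun t => lo < e.total t ∧ e.total t < hi with hT
  rcases T.eq_empty_or_nonempty with h | h
  · simp [h]
  have h1 := T.min'_mem h
  have h2 := T.max'_mem h
  have h3 : T ⊆ Icc (T.min' h) (T.max' h) := fun t ht =>
    mem_Icc.2 ⟨T.min'_le t ht, T.le_max' t ht⟩
  have h4 := card_le_card h3
  have h5 : T.min' h ≤ T.max' h := T.min'_le _ h2
  rw [Nat.card_Icc] at h4
  set s := T.min' h
  set t := T.max' h
  simp only [hT, mem_filter, mem_range] at h1 h2
  have h6 := mul_partSize_le_total_sub V h5 h2.1.le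
  have h7 : #T * partSize m n k ≤ (t - s) * partSize m n k + partSize m n k := by
    rw [← Nat.succ_mul]
    exact Nat.mul_le_mul_right _ (by omega)
  omega

theorem Collects.exists_break {f : Fin m × Fin n → Fin k} (hf : e.Collects f) {x y x' y' : ℕ}
    (hx : x < m) (hy : y < n) (hx' : x' < m) (hy' : y' < n)
    (hne : label f x y ≠ label f x' y') (hlt : e.rank m n x y < e.rank m n x' y') :
    ∃ t < k, e.rank m n x y < e.total t ∧ e.total t ≤ e.rank m n x' y' := by
  have h1 := hf (⟨x, hx⟩, ⟨y, hy⟩)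
  have h2 := hf (⟨x', hx'⟩, ⟨y', hy'⟩)
  have l1 := label_coe f (⟨x, hx⟩, ⟨y, hy⟩)
  have l2 := label_coe f (⟨x', hx'⟩, ⟨y', hy'⟩)
  simp only at h1 h2 l1 l2
  rw [l1, l2] at hne
  refine ⟨f (⟨x', hx'⟩, ⟨y', hy'⟩), Fin.is_lt _, ?_, h2.1⟩
  rcases Nat.lt_or_gt_of_ne hne with h | h
  · exact h1.2.trans_le (e.total_mono h)
  · have := e.total_mono (show _ + 1 ≤ _ from h)
    omega

/-- Pairs of cells in different parts whose ranks differ by at most `D` are few. -/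
theorem Collects.card_mul_le {f : Fin m × Fin n → Fin k} (hf : e.Collects f)
    (V : e.Valid m n k) (E : Finset (ℕ × ℕ)) (c d : ℕ × ℕ → ℕ × ℕ) (D lo hi : ℕ)
    (hin : ∀ p ∈ E, ((c p).1 < m ∧ (c p).2 < n) ∧ (d p).1 < m ∧ (d p).2 < n)
    (hne : ∀ p ∈ E, label f (c p).1 (c p).2 ≠ label f (d p).1 (d p).2)
    (hrank : ∀ p ∈ E, e.rank m n (c p).1 (c p).2 < e.rank m n (d p).1 (d p).2 ∧
      e.rank m n (d p).1 (d p).2 ≤ e.rank m n (c p).1 (c p).2 + D)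
    (hinj : ∀ p ∈ E, ∀ p' ∈ E,
      e.rank m n (c p).1 (c p).2 = e.rank m n (c p').1 (c p').2 → p = p')
    (hlo : ∀ p ∈ E, lo ≤ e.rank m n (c p).1 (c p).2)
    (hhi : ∀ p ∈ E, e.rank m n (d p).1 (d p).2 < hi) :
    #E * partSize m n k ≤ D * (hi - lo + partSize m n k) := by
  have key : ∀ p ∈ E, ∃ t, t < k ∧ e.rank m n (c p).1 (c p).2 < e.total t ∧
      e.total t ≤ e.rank m n (d p).1 (d p).2 := by
    intro p hp
    obtain ⟨⟨h1, h2⟩, h3, h4⟩ := hin p hp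
    exact hf.exists_break h1 h2 h3 h4 (hne p hp) (hrank p hp).1
  choose! τ hτk hτ1 hτ2 using key
  set T := (range k).filter fun t => lo < e.total t ∧ e.total t < hi with hT
  -- A pair is determined by a break between its ends and the distance of its earlier end from that
  -- break, for which there are at most `D` values.
  have hcard : #E ≤ #(T ×ˢ range D) := by
    refine card_le_card_of_injOn
      (fun p => (τ p, e.total (τ p) - 1 - e.rank m n (c p).1 (c p).2)) ?_ ?_
    · intro p hp
      have a1 := hτ1 p hp
      have a2 := hτ2 p hp
      have a3 := hrank p hp
      have a4 := hlo p hp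
      have a5 := hhi p hp
      simp only [hT, coe_product, Set.mem_prod, mem_coe, mem_filter, mem_range]
      exact ⟨⟨hτk p hp, by omega, by omega⟩, by omega⟩
    · intro p hp p' hp' h
      simp only [Prod.mk.injEq] at h
      obtain ⟨h1, h2⟩ := h
      have a1 := hτ1 p hp
      have a2 := hτ1 p' hp'
      rw [h1] at a1 h2
      exact hinj p hp p' hp' (by omega)
  rw [card_product, card_range] at hcard
  calc #E * partSize m n k ≤ #T * D * partSize m n k := Nat.mul_le_mul_right _ hcard
    _ = D * (#T * partSize m n k) := by ring
    _ ≤ D * (hi - lo + partSize m n k) := Nat.mul_le_mul_left D (card_breaks_mul_le V lo hi)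

theorem width_le_width_succ (V : e.Valid m n k) (ha : 0 < side m n k) {i x : ℕ}
    (hi : i < e.strips) (h1 : e.top i ≤ x) (h2 : x + 1 < e.top (i + 1)) :
    e.width n x ≤ e.width n (x + 1) ∧ e.width n (x + 1) ≤ e.width n x + 1 := by
  have hh := height_pos V ha hi
  rw [width_eq V ha hi h1 (by omega), width_eq V ha hi (by omega) h2]
  refine ⟨Nat.div_le_div_right (by omega), ?_⟩
  rw [← Nat.add_div_right _ hh]
  exact Nat.div_le_div_right (by omega)

/-- The horizontal cut edges, by position. -/
theorem Collects.card_hCuts_mul_le {f : Fin m × Fin n → Fin k} (hf : e.Collects f)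
    (V : e.Valid m n k) (ha : 0 < side m n k) {W : ℕ}
    (hW : ∀ x < e.top e.strips, e.width n x ≤ W) :
    #(hCuts f) * partSize m n k ≤ (side m n k + 1) * (m * n + partSize m n k) +
      m * partSize m n k + (m * W + partSize m n k) +
      2 * bottomHeight m n k * (n * bottomHeight m n k + partSize m n k) := by
  set A := partSize m n k with hA
  set b := bottomHeight m n k with hb
  have hsum := V.height_sum
  rw [← hb] at hsum
  have hmn : m * n = e.top e.strips * n + n * b := by rw [← hsum]; ring
  -- `E1`: both ends cut off in Step 2; the ranks differ by the strip height, at most `a + 1`. `E2`: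
  -- edges entering R, at most one per row. `E3`: inside R, consecutive ranks, the earlier end
  -- depending on the direction of the row. `E4`: in S₂; adjacent columns differ by less than twice
  -- the height, whatever their directions.
  set E1 := (hCuts f).filter fun p => p.1 < e.top e.strips ∧ p.2 + 1 < e.leftEnd n p.1 with hE1
  set E2 := (hCuts f).filter fun p => p.1 < e.top e.strips ∧ p.2 + 1 = e.leftEnd n p.1 with hE2
  set E3 := (hCuts f).filter fun p => p.1 < e.top e.strips ∧ e.leftEnd n p.1 ≤ p.2 with hE3
  set E4 := (hCuts f).filter fun p => e.top e.strips ≤ p.1 with hE4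
  have hcover : hCuts f ⊆ E1 ∪ E2 ∪ E3 ∪ E4 := by
    intro p hp
    simp only [hE1, hE2, hE3, hE4, mem_union, mem_filter, hp, true_and]
    omega
  have hc : ∀ p ∈ hCuts f, p.1 < m ∧ p.2 < n ∧ p.2 + 1 < n ∧
      label f p.1 p.2 ≠ label f p.1 (p.2 + 1) := by
    intro p hp
    simp only [hCuts, mem_filter, mem_product, mem_range] at hp
    exact ⟨hp.1.1, hp.1.2, hp.2⟩
  have c1 : #E1 * A ≤ (side m n k + 1) * (m * n - 0 + A) := by
    have hr : ∀ p ∈ E1, ∃ h, 0 < h ∧ h ≤ side m n k + 1 ∧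
        e.rank m n p.1 (p.2 + 1) = e.rank m n p.1 p.2 + h := by
      intro p hp
      obtain ⟨hp, hx, hl⟩ := mem_filter.1 hp
      obtain ⟨b1, b2, b3, -⟩ := hc p hp
      obtain ⟨i, hi, a1, a2⟩ := exists_strip hx
      refine ⟨e.height i, height_pos V ha hi, ?_, ?_⟩
      · rcases V.height_eq i hi with h | h <;> omega
      · rw [rank_left V ha hi a1 a2 b2 (by omega), rank_left V ha hi a1 a2 b3 hl]
        ring
    refine hf.card_mul_le V E1 (fun p => p) (fun p => (p.1, p.2 + 1)) _ 0 (m * n) ?_ ?_ ?_ ?_ ?_ ?_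
    · intro p hp
      obtain ⟨b1, b2, b3, -⟩ := hc p (mem_filter.1 hp).1
      exact ⟨⟨b1, b2⟩, b1, b3⟩
    · intro p hp
      exact (hc p (mem_filter.1 hp).1).2.2.2
    · intro p hp
      obtain ⟨h, h1, h2, h3⟩ := hr p hp
      simp only
      omega
    · intro p hp p' hp' h
      obtain ⟨b1, b2, -, -⟩ := hc p (mem_filter.1 hp).1
      obtain ⟨b1', b2', -, -⟩ := hc p' (mem_filter.1 hp').1
      exact Prod.ext_iff.2 (rank_inj V ha b1 b2 b1' b2' h)
    · intro p hp; exact Nat.zero_le _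
    · intro p hp
      obtain ⟨b1, b2, b3, -⟩ := hc p (mem_filter.1 hp).1
      exact rank_lt V ha b1 b3
  have c2 : #E2 ≤ m := by
    rw [← card_range m]
    refine card_le_card_of_injOn Prod.fst ?_ ?_
    · intro p hp
      exact mem_coe.2 (mem_range.2 (hc p (mem_filter.1 hp).1).1)
    · intro p hp p' hp' h
      have h1 := (mem_filter.1 hp).2.2
      have h2 := (mem_filter.1 hp').2.2
      rw [h] at h1
      exact Prod.ext h (by omega)
  have c3 : #E3 * A ≤ 1 * (e.base n (e.top e.strips) - e.base n 0 + A) := by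
    refine hf.card_mul_le V E3
      (fun p => (p.1, if e.leftToRight p.1 then p.2 else p.2 + 1))
      (fun p => (p.1, if e.leftToRight p.1 then p.2 + 1 else p.2)) _ _ _ ?_ ?_ ?_ ?_ ?_ ?_
    · intro p hp
      obtain ⟨b1, b2, b3, -⟩ := hc p (mem_filter.1 hp).1
      refine ⟨⟨b1, ?_⟩, b1, ?_⟩ <;> simp only <;> split_ifs <;> assumption
    · intro p hp
      obtain ⟨b1, b2, b3, b4⟩ := hc p (mem_filter.1 hp).1
      simp only
      split_ifs
      · exact b4
      · exact b4.symm
    · intro p hp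
      obtain ⟨hp, hx, hl⟩ := mem_filter.1 hp
      obtain ⟨b1, b2, b3, -⟩ := hc p hp
      simp only
      by_cases hd : e.leftToRight p.1 = true
      · simp only [hd, if_true]
        rw [rank_mid V ha hx b2 hl, rank_mid V ha hx b3 (by omega), if_pos hd, if_pos hd]
        omega
      · simp only [hd]
        rw [if_neg (by simp), if_neg (by simp),
          rank_mid V ha hx b2 hl, rank_mid V ha hx b3 (by omega), if_neg hd, if_neg hd]
        omega
    · intro p hp p' hp' h
      obtain ⟨b1, b2, b3, -⟩ := hc p (mem_filter.1 hp).1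
      obtain ⟨b1', b2', b3', -⟩ := hc p' (mem_filter.1 hp').1
      simp only at h
      have := rank_inj V ha b1 (by split_ifs <;> omega) b1' (by split_ifs <;> omega) h
      obtain ⟨h1, h2⟩ := this
      rw [h1] at h2
      refine Prod.ext h1 ?_
      split_ifs at h2 <;> omega
    · intro p hp
      obtain ⟨hp, hx, hl⟩ := mem_filter.1 hp
      obtain ⟨b1, b2, b3, -⟩ := hc p hp
      have := (rank_mid_mem V ha (y := if e.leftToRight p.1 then p.2 else p.2 + 1) hx
        (by split_ifs <;> omega) (by split_ifs <;> omega)).1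
      exact (e.base_mono n (Nat.zero_le _)).trans this
    · intro p hp
      obtain ⟨hp, hx, hl⟩ := mem_filter.1 hp
      obtain ⟨b1, b2, b3, -⟩ := hc p hp
      have := (rank_mid_mem V ha (y := if e.leftToRight p.1 then p.2 + 1 else p.2) hx
        (by split_ifs <;> omega) (by split_ifs <;> omega)).2
      exact this.trans_le (e.base_mono n hx)
  have c4 : #E4 * A ≤ 2 * b * (m * n - e.top e.strips * n + A) := by
    refine hf.card_mul_le V E4 (fun p => (p.1, p.2 + 1)) (fun p => p) _ _ _ ?_ ?_ ?_ ?_ ?_ ?_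
    · intro p hp
      obtain ⟨b1, b2, b3, -⟩ := hc p (mem_filter.1 hp).1
      exact ⟨⟨b1, b3⟩, b1, b2⟩
    · intro p hp
      exact (hc p (mem_filter.1 hp).1).2.2.2.symm
    · intro p hp
      obtain ⟨hp, hx⟩ := mem_filter.1 hp
      obtain ⟨b1, b2, b3, -⟩ := hc p hp
      simp only
      rw [rank_bottom V hx, rank_bottom V hx, ← hb]
      have e1 : (n - 1 - p.2) * b = (n - 1 - (p.2 + 1)) * b + b := by
        rw [← Nat.succ_mul]; congr 1; omega
      split_ifs <;> omega
    · intro p hp p' hp' h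
      obtain ⟨b1, b2, b3, -⟩ := hc p (mem_filter.1 hp).1
      obtain ⟨b1', b2', b3', -⟩ := hc p' (mem_filter.1 hp').1
      have := rank_inj V ha b1 b3 b1' b3' h
      exact Prod.ext this.1 (by simpa using this.2)
    · intro p hp
      obtain ⟨hp, hx⟩ := mem_filter.1 hp
      obtain ⟨b1, b2, b3, -⟩ := hc p hp
      exact (rank_bottom_mem V hx b1 b3).1
    · intro p hp
      obtain ⟨hp, hx⟩ := mem_filter.1 hp
      obtain ⟨b1, b2, b3, -⟩ := hc p hp
      exact (rank_bottom_mem V hx b1 b2).2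
  have hlen : e.base n (e.top e.strips) - e.base n 0 ≤ m * W := by
    rw [base_zero, base, Nat.add_sub_cancel_left]
    calc ∑ z ∈ range (e.top e.strips), (n - e.leftEnd n z)
        ≤ ∑ z ∈ range (e.top e.strips), W := sum_le_sum fun z hz => hW z (mem_range.1 hz)
      _ = e.top e.strips * W := by simp
      _ ≤ m * W := Nat.mul_le_mul_right W (by omega)
  have h4 : m * n - e.top e.strips * n = n * b := by omega
  rw [h4] at c4
  rw [Nat.sub_zero] at c1
  rw [one_mul] at c3
  have hcard : #(hCuts f) ≤ #E1 + #E2 + #E3 + #E4 :=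
    (card_le_card hcover).trans ((card_union_le _ _).trans (Nat.add_le_add_right
      ((card_union_le _ _).trans (Nat.add_le_add_right (card_union_le _ _) _)) _))
  calc #(hCuts f) * A ≤ (#E1 + #E2 + #E3 + #E4) * A := Nat.mul_le_mul_right A hcard
    _ = #E1 * A + #E2 * A + #E3 * A + #E4 * A := by ring
    _ ≤ _ := by
      have := Nat.mul_le_mul_right A c2
      omega

/-- The vertical cut edges, by position. -/
theorem Collects.card_vCuts_mul_le {f : Fin m × Fin n → Fin k} (hf : e.Collects f)
    (V : e.Valid m n k) (ha : 0 < side m n k) {W : ℕ}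
    (hW : ∀ x < e.top e.strips, e.width n x ≤ W) :
    #(vCuts f) * partSize m n k ≤ (m * n + partSize m n k) +
      m * partSize m n k + 2 * W * (m * W + partSize m n k) +
      (n * bottomHeight m n k + partSize m n k) + e.strips * n * partSize m n k := by
  set A := partSize m n k with hA
  set b := bottomHeight m n k with hb
  have hsum := V.height_sum
  rw [← hb] at hsum
  have hmn : m * n = e.top e.strips * n + n * b := by rw [← hsum]; ring
  let inner : ℕ → Prop := fun x => ∃ i < e.strips, e.top i ≤ x ∧ x + 1 < e.top (i + 1)
  have hinner : ∀ x, inner x → x + 1 < e.top e.strips := by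
    rintro x ⟨i, hi, -, h2⟩
    exact h2.trans_le (e.top_mono hi)
  classical
  -- `E1`: inside a strip, both ends cut off in Step 2, consecutive ranks. `E2`: from a cell cut off
  -- in Step 2 down into R; the border moves by at most one column, so at most one per row. `E3`:
  -- both ends in R, less than two row lengths apart. `E4`: in S₂, consecutive ranks. `E5`: below
  -- the last row of a strip, where all edges are counted. The families cover the cut edges and may
  -- overlap.
  set E1 := (vCuts f).filter fun p => inner p.1 ∧ p.2 < e.leftEnd n (p.1 + 1) with hE1
  set E2 := (vCuts f).filter fun p => inner p.1 ∧ e.leftEnd n (p.1 + 1) ≤ p.2 ∧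
    p.2 < e.leftEnd n p.1 with hE2
  set E3 := (vCuts f).filter fun p => p.1 + 1 < e.top e.strips ∧ e.leftEnd n (p.1 + 1) ≤ p.2 ∧
    e.leftEnd n p.1 ≤ p.2 with hE3
  set E4 := (vCuts f).filter fun p => e.top e.strips ≤ p.1 with hE4
  set E5 := (vCuts f).filter fun p => ∃ i < e.strips, p.1 + 1 = e.top (i + 1) with hE5
  have hcover : vCuts f ⊆ E1 ∪ E2 ∪ E3 ∪ E4 ∪ E5 := by
    intro p hp
    simp only [hE1, hE2, hE3, hE4, hE5, mem_union, mem_filter, hp, true_and]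
    rcases lt_or_ge p.1 (e.top e.strips) with hx | hx
    · obtain ⟨i, hi, a1, a2⟩ := exists_strip hx
      rcases Nat.lt_or_ge (p.1 + 1) (e.top (i + 1)) with h | h
      · have hin : inner p.1 := ⟨i, hi, a1, h⟩
        have := hinner _ hin
        simp only [hin, true_and]
        omega
      · exact Or.inr ⟨i, hi, by omega⟩
    · exact Or.inl (Or.inr hx)
  have hc : ∀ p ∈ vCuts f, p.1 < m ∧ p.2 < n ∧ p.1 + 1 < m ∧
      label f p.1 p.2 ≠ label f (p.1 + 1) p.2 := by
    intro p hp
    simp only [vCuts, mem_filter, mem_product, mem_range] at hp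
    exact ⟨hp.1.1, hp.1.2, hp.2⟩
  have hleft : ∀ x, inner x → e.leftEnd n (x + 1) ≤ e.leftEnd n x ∧
      e.leftEnd n x ≤ e.leftEnd n (x + 1) + 1 := by
    rintro x ⟨i, hi, h1, h2⟩
    have h3 := width_le_width_succ V ha hi h1 h2
    have := e.leftEnd_le n x
    have := e.leftEnd_le n (x + 1)
    rw [width, width] at h3
    omega
  have c1 : #E1 * A ≤ 1 * (m * n - 0 + A) := by
    refine hf.card_mul_le V E1 (fun p => p) (fun p => (p.1 + 1, p.2)) _ 0 (m * n) ?_ ?_ ?_ ?_ ?_ ?_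
    · intro p hp
      obtain ⟨b1, b2, b3, -⟩ := hc p (mem_filter.1 hp).1
      exact ⟨⟨b1, b2⟩, b3, b2⟩
    · intro p hp
      exact (hc p (mem_filter.1 hp).1).2.2.2
    · intro p hp
      obtain ⟨hp, hin, hl⟩ := mem_filter.1 hp
      obtain ⟨b1, b2, b3, -⟩ := hc p hp
      have := hleft _ hin
      obtain ⟨i, hi, h1, h2⟩ := hin
      simp only
      rw [rank_left V ha hi h1 (by omega) b2 (by omega),
        rank_left V ha hi (by omega) h2 b2 hl]
      omega
    · intro p hp p' hp' h
      obtain ⟨b1, b2, -, -⟩ := hc p (mem_filter.1 hp).1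
      obtain ⟨b1', b2', -, -⟩ := hc p' (mem_filter.1 hp').1
      exact Prod.ext_iff.2 (rank_inj V ha b1 b2 b1' b2' h)
    · intro p hp; exact Nat.zero_le _
    · intro p hp
      obtain ⟨b1, b2, b3, -⟩ := hc p (mem_filter.1 hp).1
      exact rank_lt V ha b3 b2
  have c2 : #E2 ≤ m := by
    rw [← card_range m]
    refine card_le_card_of_injOn Prod.fst ?_ ?_
    · intro p hp
      exact mem_coe.2 (mem_range.2 (hc p (mem_filter.1 hp).1).1)
    · intro p hp p' hp' h
      obtain ⟨-, q0, q1, q2⟩ := mem_filter.1 hp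
      obtain ⟨-, q3, q4, q5⟩ := mem_filter.1 hp'
      have := hleft _ q0
      rw [← h] at q4 q5
      exact Prod.ext h (by omega)
  have c3 : #E3 * A ≤ 2 * W * (e.base n (e.top e.strips) - e.base n 0 + A) := by
    refine hf.card_mul_le V E3 (fun p => p) (fun p => (p.1 + 1, p.2)) _ _ _ ?_ ?_ ?_ ?_ ?_ ?_
    · intro p hp
      obtain ⟨b1, b2, b3, -⟩ := hc p (mem_filter.1 hp).1
      exact ⟨⟨b1, b2⟩, b3, b2⟩
    · intro p hp
      exact (hc p (mem_filter.1 hp).1).2.2.2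
    · intro p hp
      obtain ⟨hp, hx, h1, h2⟩ := mem_filter.1 hp
      obtain ⟨b1, b2, b3, -⟩ := hc p hp
      have r1 := rank_mid_mem V ha (show p.1 < _ by omega) b2 h2
      have r2 := rank_mid_mem V ha hx b2 h1
      have s1 := e.base_succ n p.1
      have s2 := e.base_succ n (p.1 + 1)
      have w1 := hW p.1 (by omega)
      have w2 := hW (p.1 + 1) hx
      simp only
      omega
    · intro p hp p' hp' h
      obtain ⟨b1, b2, -, -⟩ := hc p (mem_filter.1 hp).1
      obtain ⟨b1', b2', -, -⟩ := hc p' (mem_filter.1 hp').1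
      exact Prod.ext_iff.2 (rank_inj V ha b1 b2 b1' b2' h)
    · intro p hp
      obtain ⟨hp, hx, h1, h2⟩ := mem_filter.1 hp
      obtain ⟨b1, b2, b3, -⟩ := hc p hp
      exact (e.base_mono n (Nat.zero_le _)).trans
        (rank_mid_mem V ha (show p.1 < _ by omega) b2 h2).1
    · intro p hp
      obtain ⟨hp, hx, h1, h2⟩ := mem_filter.1 hp
      obtain ⟨b1, b2, b3, -⟩ := hc p hp
      exact (rank_mid_mem V ha hx b2 h1).2.trans_le (e.base_mono n hx)
  have c4 : #E4 * A ≤ 1 * (m * n - e.top e.strips * n + A) := by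
    refine hf.card_mul_le V E4
      (fun p => (if e.topToBottom p.2 then p.1 else p.1 + 1, p.2))
      (fun p => (if e.topToBottom p.2 then p.1 + 1 else p.1, p.2)) _ _ _ ?_ ?_ ?_ ?_ ?_ ?_
    · intro p hp
      obtain ⟨b1, b2, b3, -⟩ := hc p (mem_filter.1 hp).1
      refine ⟨⟨?_, b2⟩, ?_, b2⟩ <;> simp only <;> split_ifs <;> assumption
    · intro p hp
      obtain ⟨b1, b2, b3, b4⟩ := hc p (mem_filter.1 hp).1
      simp only
      split_ifs
      · exact b4
      · exact b4.symm
    · intro p hp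
      obtain ⟨hp, hx⟩ := mem_filter.1 hp
      obtain ⟨b1, b2, b3, -⟩ := hc p hp
      simp only
      by_cases hd : e.topToBottom p.2 = true
      · simp only [hd, if_true]
        rw [rank_bottom V hx, rank_bottom V (by omega), if_pos hd, if_pos hd]
        omega
      · simp only [hd]
        rw [if_neg (by simp), if_neg (by simp),
          rank_bottom V hx, rank_bottom V (by omega), if_neg hd, if_neg hd]
        omega
    · intro p hp p' hp' h
      obtain ⟨b1, b2, b3, -⟩ := hc p (mem_filter.1 hp).1
      obtain ⟨b1', b2', b3', -⟩ := hc p' (mem_filter.1 hp').1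
      simp only at h
      have := rank_inj V ha (by split_ifs <;> omega) b2 (by split_ifs <;> omega) b2' h
      obtain ⟨h1, h2⟩ := this
      rw [h2] at h1
      refine Prod.ext ?_ h2
      split_ifs at h1 <;> omega
    · intro p hp
      obtain ⟨hp, hx⟩ := mem_filter.1 hp
      obtain ⟨b1, b2, b3, -⟩ := hc p hp
      exact (rank_bottom_mem V (by simp only; split_ifs <;> omega)
        (by simp only; split_ifs <;> omega) b2).1
    · intro p hp
      obtain ⟨hp, hx⟩ := mem_filter.1 hp
      obtain ⟨b1, b2, b3, -⟩ := hc p hp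
      exact (rank_bottom_mem V (by simp only; split_ifs <;> omega)
        (by simp only; split_ifs <;> omega) b2).2
  have c5 : #E5 ≤ e.strips * n := by
    have : E5 ⊆ ((range e.strips) ×ˢ range n).image fun q => (e.top (q.1 + 1) - 1, q.2) := by
      intro p hp
      obtain ⟨hp, i, hi, h⟩ := mem_filter.1 hp
      obtain ⟨b1, b2, b3, -⟩ := hc p hp
      refine mem_image.2 ⟨(i, p.2), by simp [hi, b2], Prod.ext ?_ rfl⟩
      simp only
      omega
    calc #E5 ≤ _ := card_le_card this
      _ ≤ #((range e.strips) ×ˢ range n) := card_image_le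
      _ = e.strips * n := by simp
  have hlen : e.base n (e.top e.strips) - e.base n 0 ≤ m * W := by
    rw [base_zero, base, Nat.add_sub_cancel_left]
    calc ∑ z ∈ range (e.top e.strips), (n - e.leftEnd n z)
        ≤ ∑ z ∈ range (e.top e.strips), W := sum_le_sum fun z hz => hW z (mem_range.1 hz)
      _ = e.top e.strips * W := by simp
      _ ≤ m * W := Nat.mul_le_mul_right W (by omega)
  have h4 : m * n - e.top e.strips * n = n * b := by omega
  rw [h4, one_mul] at c4
  rw [Nat.sub_zero, one_mul] at c1
  have c3' : #E3 * A ≤ 2 * W * (m * W + A) :=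
    c3.trans (Nat.mul_le_mul_left _ (Nat.add_le_add_right hlen A))
  have hcard : #(vCuts f) ≤ #E1 + #E2 + #E3 + #E4 + #E5 :=
    (card_le_card hcover).trans ((card_union_le _ _).trans (Nat.add_le_add_right
      ((card_union_le _ _).trans (Nat.add_le_add_right
      ((card_union_le _ _).trans (Nat.add_le_add_right (card_union_le _ _) _)) _)) _))
  calc #(vCuts f) * A ≤ (#E1 + #E2 + #E3 + #E4 + #E5) * A := Nat.mul_le_mul_right A hcard
    _ = #E1 * A + #E2 * A + #E3 * A + #E4 * A + #E5 * A := by ring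
    _ ≤ _ := by
      have := Nat.mul_le_mul_right A c2
      have := Nat.mul_le_mul_right A c5
      omega

end Choices

/-! ### Connectivity of the parts of an execution -/

namespace Choices

variable {e : Choices} {m n k : ℕ}

/-- Conditions under which the parts produced by an execution are connected. -/
structure Tidy (e : Choices) (m n k : ℕ) : Prop where
  height_lt : ∀ i < e.strips, e.height i = 1 ∨ e.height i + 1 ≤ partSize m n k
  bottom_lt : 0 < bottomHeight m n k → bottomHeight m n k + 1 ≤ partSize m n k
  down : ∀ y, e.topToBottom y = true
  /-- rows of `R` without vertices come first -/
  width_pos : ∀ z z', z ≤ z' → z' < e.top e.strips → 0 < e.width n z → 0 < e.width n z'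
  width_lt : ∀ z < e.top e.strips, ∀ t < k, e.start e.strips ≤ t → e.width n z < e.size t
  /-- in a row traversed to the left, the last vertices are adjacent to the next row -/
  next_row : ∀ z, z + 1 < e.top e.strips → e.leftToRight z = false →
    ∀ t < k, e.base n z < e.total t → e.total t < e.base n (z + 1) →
      e.width n z < e.width n (z + 1) + (e.base n (z + 1) - e.total t)
  /-- in a row traversed to the right, the first vertices are adjacent to the previous row -/
  prev_row : ∀ z, z + 1 < e.top e.strips → e.leftToRight (z + 1) = true →
    ∀ t < k, e.base n (z + 1) < e.total t → e.total t < e.base n (z + 2) →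
      e.width n (z + 1) < e.width n z + (e.total t - e.base n (z + 1))
  /-- a part that begins inside the last row of `R` reaches the second column of `S₂` -/
  last_row : ∀ z, z + 1 = e.top e.strips → 0 < bottomHeight m n k → e.leftToRight z = false →
    ∀ t < k, e.base n z < e.total t → e.total t < e.base n (z + 1) →
      e.width n z ≤ e.base n (z + 1) - e.total t + 1 ∧
        e.base n (z + 1) + bottomHeight m n k < e.total (t + 1)

theorem partSize_le_size (V : e.Valid m n k) {t : ℕ} (ht : t < k) :
    partSize m n k ≤ e.size t := by
  rcases V.size_eq t ht with h | h <;> omega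

/-- The parts cut off in Step 2 are connected. -/
theorem Collects.connected_left {f : Fin m × Fin n → Fin k} (hf : e.Collects f)
    (V : e.Valid m n k) (ha : 0 < side m n k) (hA : 0 < partSize m n k)
    (hh : ∀ i < e.strips, e.height i = 1 ∨ e.height i + 1 ≤ partSize m n k)
    (i : Fin k) (hi : (i : ℕ) < e.start e.strips) :
    ((grid m n).induce {v | f v = i}).Connected := by
  obtain ⟨j, hj, hj1, hj2⟩ := exists_le_lt_succ (by simp [start]) hi
  have hs := partSize_le_size V i.2
  have ht1 := e.total_mono hj1
  have ht2 := e.total_mono (show (i : ℕ) + 1 ≤ e.start (j + 1) from hj2)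
  have ht3 := e.total_start_succ j
  have ht4 := e.total_succ i
  have hb0 := e.base_zero n
  have hmono := e.total_mono (e.start_mono (show j + 1 ≤ e.strips from hj))
  have hu := V.used_le j hj
  have hpos := height_pos V ha hj
  have htopj := e.top_succ j
  have htop := e.top_mono (show j + 1 ≤ e.strips from hj)
  have hsum := V.height_sum
  -- The part is a window of consecutive positions in strip `j`, with the columns as layers.
  have hset : {v : Fin m × Fin n | f v = i} = {v | (e.top j ≤ v.1.val ∧ v.1.val < e.top (j + 1)) ∧
      e.total i - e.total (e.start j) ≤ v.2.val * e.height j + (v.1.val - e.top j) ∧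
      v.2.val * e.height j + (v.1.val - e.top j) <
        e.total i - e.total (e.start j) + e.size i} := by
    ext v
    simp only [Set.mem_ofPred_eq]
    rw [hf.eq_iff]
    constructor
    · rintro ⟨h1, h2⟩
      have hx : v.1.val < e.top e.strips := by
        by_contra hx
        have := (rank_bottom_mem V (not_lt.1 hx) v.1.2 v.2.2).1
        rw [← base_strips V ha] at this
        have := e.base_mono n (Nat.zero_le (e.top e.strips))
        omega
      have hl : v.2.val < e.leftEnd n v.1 := by
        by_contra hl
        have := (rank_mid_mem V ha hx v.2.2 (not_lt.1 hl)).1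
        have := e.base_mono n (Nat.zero_le v.1.val)
        omega
      obtain ⟨j', hj', a1, a2⟩ := exists_strip hx
      have hp := (pos_lt_used_iff V ha hj' a1 a2 v.2.2).2 hl
      have hr := rank_left V ha hj' a1 a2 v.2.2 hl
      have hs' := e.total_start_succ j'
      have key : j' = j := by
        rcases lt_trichotomy j' j with q | q | q
        · have := e.total_mono (e.start_mono (show j' + 1 ≤ j from q)); omega
        · exact q
        · have := e.total_mono (e.start_mono (show j + 1 ≤ j' from q)); omega
      subst key
      exact ⟨⟨a1, a2⟩, by omega, by omega⟩
    · rintro ⟨⟨a1, a2⟩, h1, h2⟩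
      have hl := (pos_lt_used_iff V ha hj a1 a2 v.2.2).1 (by omega)
      rw [rank_left V ha hj a1 a2 v.2.2 hl]
      omega
  rw [hset]
  refine consecutive_connected (fun v : Fin m × Fin n => e.top j ≤ v.1.val ∧ v.1.val < e.top (j + 1))
    (fun v => v.2.val) (fun v => v.1.val - e.top j) (e.height j) n _ _ ?_ ?_ ?_ ?_ ?_ ?_ (by omega)
    hpos ?_
  · rintro u v ⟨hu, -⟩ ⟨hv, -⟩ h1 h2
    exact Prod.ext (Fin.ext (by omega)) (Fin.ext h1)
  · rintro u v ⟨hu, -⟩ ⟨hv, -⟩ h1 h2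
    exact grid_adj_down u v h1 (by omega)
  · rintro u v ⟨hu, -⟩ ⟨hv, -⟩ h1 h2
    exact grid_adj_right u v (by omega) h2
  · rintro v ⟨h1, h2⟩
    omega
  · intro x y hx hy
    refine ⟨(⟨e.top j + y, by omega⟩, ⟨x, hx⟩), ⟨?_, ?_⟩, ?_, ?_⟩ <;> simp only <;> omega
  · rcases hh j hj with h | h
    · exact Or.inr h
    · exact Or.inl (by omega)
  · rw [mul_comm]; omega

/-- The parts made from the bottom strip alone are connected. -/
theorem Collects.connected_bottom {f : Fin m × Fin n → Fin k} (hf : e.Collects f)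
    (V : e.Valid m n k) (ha : 0 < side m n k) (hA : 0 < partSize m n k)
    (hb : 0 < bottomHeight m n k → bottomHeight m n k + 1 ≤ partSize m n k)
    (hd : ∀ y, e.topToBottom y = true)
    (i : Fin k) (hi : e.top e.strips * n ≤ e.total i) :
    ((grid m n).induce {v | f v = i}).Connected := by
  have hs := partSize_le_size V i.2
  have ht4 := e.total_succ i
  have hsum := V.height_sum
  have hk := e.total_mono (show (i : ℕ) + 1 ≤ k from i.2)
  rw [total_k V] at hk
  have hmn : m * n = e.top e.strips * n + n * bottomHeight m n k := by
    rw [← hsum, add_mul, mul_comm n, hsum]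
  have hb0 : 0 < bottomHeight m n k := by
    by_contra h
    have : bottomHeight m n k = 0 := by omega
    rw [this] at hmn
    omega
  have hset : {v : Fin m × Fin n | f v = i} = {v | e.top e.strips ≤ v.1.val ∧
      e.total i - e.top e.strips * n ≤
        (n - 1 - v.2.val) * bottomHeight m n k + (v.1.val - e.top e.strips) ∧
      (n - 1 - v.2.val) * bottomHeight m n k + (v.1.val - e.top e.strips) <
        e.total i - e.top e.strips * n + e.size i} := by
    ext v
    simp only [Set.mem_ofPred_eq]
    rw [hf.eq_iff]
    constructor
    · rintro ⟨h1, h2⟩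
      have hx : e.top e.strips ≤ v.1.val := by
        by_contra hx
        have h0 := base_strips V ha
        rcases lt_or_ge v.2.val (e.leftEnd n v.1) with hl | hl
        · have := rank_left_lt V ha (not_le.1 hx) v.2.2 hl
          have := e.base_mono n (Nat.zero_le (e.top e.strips))
          omega
        · have := (rank_mid_mem V ha (not_le.1 hx) v.2.2 hl).2
          have := e.base_mono n (not_le.1 hx)
          simp only [Nat.succ_eq_add_one] at this
          omega
      rw [rank_bottom V hx, if_pos (hd _)] at h1 h2
      exact ⟨hx, by omega, by omega⟩
    · rintro ⟨hx, h1, h2⟩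
      rw [rank_bottom V hx, if_pos (hd _)]
      omega
  rw [hset]
  refine consecutive_connected (fun v : Fin m × Fin n => e.top e.strips ≤ v.1.val)
    (fun v => n - 1 - v.2.val) (fun v => v.1.val - e.top e.strips) (bottomHeight m n k) n _ _
    ?_ ?_ ?_ ?_ ?_ ?_ (by omega) hb0 (by omega)
  · rintro u v hu hv h1 h2
    have := u.2.2
    have := v.2.2
    exact Prod.ext (Fin.ext (by omega)) (Fin.ext (by omega))
  · rintro u v hu hv h1 h2
    have := u.2.2
    have := v.2.2
    exact grid_adj_down u v (by omega) (by omega)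
  · rintro u v hu hv h1 h2
    have := u.2.2
    have := v.2.2
    exact (grid_adj_right v u (by omega) (by omega)).symm
  · rintro v h1
    have := v.1.2
    omega
  · intro x y hx hy
    refine ⟨(⟨e.top e.strips + y, by omega⟩, ⟨n - 1 - x, by omega⟩), ?_, ?_, ?_⟩ <;> simp only <;>
      omega
  · exact Or.inl (by have := hb hb0; omega)

/-- The parts begun in the region `R` are connected. -/
theorem Collects.connected_mid {f : Fin m × Fin n → Fin k} (hf : e.Collects f)
    (V : e.Valid m n k) (ha : 0 < side m n k) (hA : 0 < partSize m n k) (H : e.Tidy m n k)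
    (i : Fin k) (hi : e.start e.strips ≤ i) (hi' : e.total i < e.top e.strips * n) :
    ((grid m n).induce {v | f v = i}).Connected := by
  have hs := partSize_le_size V i.2
  have ht4 := e.total_succ i
  have hsum := V.height_sum
  have hk := e.total_mono (show (i : ℕ) + 1 ≤ k from i.2)
  have hstart := e.total_mono hi
  rw [← e.base_zero n] at hstart
  have hbt := base_strips V ha
  have hbk : e.base n (e.top e.strips) ≤ e.total k := by
    rw [total_k V, hbt]
    exact Nat.mul_le_mul_right n (by omega)
  have hmem : ∀ v : Fin m × Fin n, f v = i ↔
      e.total i ≤ e.rank m n v.1 v.2 ∧ e.rank m n v.1 v.2 < e.total (i + 1) :=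
    fun v => hf.eq_iff v i
  have hmid : ∀ v : Fin m × Fin n, f v = i → v.1.val < e.top e.strips →
      e.leftEnd n v.1 ≤ v.2.val := by
    intro v hv hx
    by_contra hl
    have := rank_left_lt V ha hx v.2.2 (not_le.1 hl)
    have := ((hmem v).1 hv).1
    omega
  refine layered_connected (fun v => v.1.val) (fun v => v.2.val)
    (fun u _ v _ h1 h2 => Prod.ext (Fin.ext h1) (Fin.ext h2))
    (fun u _ v _ h1 h2 => grid_adj_right u v h1 h2)
    (fun u _ v _ h1 h2 => grid_adj_down u v h1 h2) ?_ ?_ ?_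
  -- Along a row of R or of S₂ the rank is monotone in the column, so a part meets the row in an
  -- interval.
  · rintro ⟨x, y1⟩ hu ⟨x', y2⟩ hv hxx y h1 h2
    obtain rfl : x = x' := Fin.ext hxx
    simp only [Set.mem_ofPred_eq] at hu hv h1 h2
    have hu' := (hmem _).1 hu
    have hv' := (hmem _).1 hv
    have hyn : y < n := lt_of_le_of_lt h2 y2.2
    refine ⟨(x, ⟨y, hyn⟩), ?_, rfl, rfl⟩
    simp only [Set.mem_ofPred_eq]
    rw [hmem]
    simp only at hu' hv' ⊢
    rcases lt_or_ge x.val (e.top e.strips) with hx | hx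
    · have l1 := hmid _ hu hx
      have l2 := hmid _ hv hx
      simp only at l1 l2
      rw [rank_mid V ha hx y1.2 l1] at hu'
      rw [rank_mid V ha hx y2.2 l2] at hv'
      rw [rank_mid V ha hx hyn (by omega)]
      split_ifs at hu' hv' ⊢ <;> omega
    · rw [rank_bottom V hx, if_pos (H.down _)] at hu' hv' ⊢
      have b1 := Nat.mul_le_mul_right (bottomHeight m n k) (show n - 1 - y2.val ≤ n - 1 - y by omega)
      have b2 := Nat.mul_le_mul_right (bottomHeight m n k) (show n - 1 - y ≤ n - 1 - y1.val by omega)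
      omega
  · rintro ⟨x₀, y₀⟩ hu ⟨x, y⟩ hv hlt
    simp only [Set.mem_ofPred_eq] at hu hv hlt
    have hu' := (hmem _).1 hu
    have hv' := (hmem _).1 hv
    simp only at hu' hv'
    have suff : (∃ (y' : ℕ) (hy' : y' < n), f (⟨x.val - 1, by omega⟩, ⟨y', hy'⟩) = i ∧
        f (x, ⟨y', hy'⟩) = i) → ∃ u' ∈ {v | f v = i}, ∃ v' ∈ {v | f v = i},
        u'.1.val + 1 = x.val ∧ v'.1.val = x.val ∧ u'.2.val = v'.2.val := by
      rintro ⟨y', h1, h2, h3⟩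
      exact ⟨_, h2, _, h3, by simp only; omega, rfl, rfl⟩
    apply suff
    simp only [hmem]
    obtain ⟨z, hz⟩ : ∃ z, x.val = z + 1 := ⟨x.val - 1, by omega⟩
    have hzm : z + 1 < m := hz ▸ x.2
    simp only [hz, Nat.add_sub_cancel] at hv' hlt ⊢
    have hy := y.2
    have hy0 := y₀.2
    -- If both rows lie in S₂, the cell above `v` has rank one less and still belongs to the part,
    -- which began in R.
    rcases lt_or_ge (e.top e.strips) (z + 1) with hx | hx
    · rw [rank_bottom V (by omega), if_pos (H.down _)] at hv'
      refine ⟨y, y.2, ?_⟩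
      rw [rank_bottom V (show e.top e.strips ≤ z by omega),
        rank_bottom V (show e.top e.strips ≤ z + 1 by omega), if_pos (H.down _), if_pos (H.down _)]
      omega
    have hx0 : x₀.val < e.top e.strips := by omega
    have l0 := hmid _ hu hx0
    have r0 := rank_mid_mem V ha hx0 y₀.2 l0
    simp only at l0 r0
    have hw0 : 0 < e.width n z := by
      refine H.width_pos x₀ z (by omega) (by omega) ?_
      rw [width]; omega
    have hbz := e.base_succ n z
    have hb1 := e.base_mono n (show x₀.val + 1 ≤ z + 1 by omega)
    have hsz := H.width_lt z (by omega) i i.2 hi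
    have hlz : e.width n z = n - e.leftEnd n z := rfl
    rcases hx.eq_or_lt with hx | hx
    · have hv1 := (rank_bottom_mem V (show e.top e.strips ≤ z + 1 by omega) hzm hy).1
      rw [← hbt, ← hx] at hv1
      have hbot : ∀ y', e.rank m n (z + 1) y' =
          e.base n (z + 1) + (n - 1 - y') * bottomHeight m n k := by
        intro y'
        rw [rank_bottom V (by omega), if_pos (H.down _), hx, hbt]
        omega
      -- From the last row of R into S₂. The first cell taken in S₂ is in column `n - 1`; this
      -- column serves if the row ends there or lies entirely after the beginning of the part.
      by_cases hdir : e.leftToRight z = true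
      · refine ⟨n - 1, by omega, ?_⟩
        rw [hbot, rank_mid V ha (by omega) (by omega) (by omega), if_pos hdir, Nat.sub_self,
          zero_mul]
        omega
      · rcases le_or_gt (e.total i) (e.base n z) with hT | hT
        · refine ⟨n - 1, by omega, ?_⟩
          rw [hbot, rank_mid V ha (by omega) (by omega) (by omega), if_neg hdir, Nat.sub_self,
            zero_mul]
          omega
        -- The part may miss the cell in column `n - 1` of the row but no other, and it reaches the
        -- second column of S₂; hence column `n - 2`.
        · have := H.last_row z hx (by omega) (by simpa using hdir) i i.2 hT (by omega)
          refine ⟨n - 2, by omega, ?_⟩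
          rw [hbot, rank_mid V ha (by omega) (by omega) (by omega), if_neg hdir,
            show n - 1 - (n - 2) = 1 by omega, one_mul]
          omega
    · have lx := hmid _ hv (by simp only; omega)
      simp only [hz] at lx
      have rx := rank_mid_mem V ha hx y.2 lx
      rw [show z + 1 + 1 = z + 2 from rfl] at rx
      have hbx : e.base n (z + 2) = e.base n (z + 1) + e.width n (z + 1) := e.base_succ n (z + 1)
      have hlx : e.width n (z + 1) = n - e.leftEnd n (z + 1) := rfl
      have hsx := H.width_lt (z + 1) hx i i.2 hi
      have hnext : e.leftToRight z = false → e.base n z < e.total i →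
          e.width n z < e.width n (z + 1) + (e.base n (z + 1) - e.total i) :=
        fun h1 h2 => H.next_row z hx h1 i i.2 h2 (by omega)
      have hprev : e.leftToRight (z + 1) = true → e.total (i + 1) < e.base n (z + 2) →
          e.width n (z + 1) < e.width n z + (e.total (i + 1) - e.base n (z + 1)) := by
        intro h1 h2
        refine H.prev_row z hx h1 (i + 1) ?_ (by omega) h2
        by_contra hik
        have h3 : (i : ℕ) + 1 = k := by have := i.2; omega
        rw [h3] at h2
        have := e.base_mono n (show z + 2 ≤ e.top e.strips from hx)
        omega
      have suff : (∃ y', y' < n ∧ e.leftEnd n z ≤ y' ∧ e.leftEnd n (z + 1) ≤ y' ∧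
          e.total i ≤ e.rank m n z y' ∧ e.rank m n (z + 1) y' < e.total (i + 1)) →
          ∃ (y' : ℕ) (_ : y' < n),
          (e.total i ≤ e.rank m n z y' ∧ e.rank m n z y' < e.total (i + 1)) ∧
          e.total i ≤ e.rank m n (z + 1) y' ∧ e.rank m n (z + 1) y' < e.total (i + 1) := by
        rintro ⟨y', h0, h1, h2, h3, h4⟩
        have := rank_mid_mem V ha (by omega) h0 h1
        have := rank_mid_mem V ha hx h0 h2
        exact ⟨y', h0, ⟨h3, by omega⟩, by omega, h4⟩
      refine suff ?_
      -- A common column of the two rows. Right then left: both traversals use column `n - 1`. Left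
      -- then left: the column where the part begins or, if it began earlier, `n - 1`. If row `z +
      -- 1` goes right: the leftmost column that is in both rows and, in row `z`, in the part.
      by_cases hdz : e.leftToRight z = true <;> by_cases hdx : e.leftToRight (z + 1) = true
      · refine ⟨max (max (e.leftEnd n z) (e.leftEnd n (z + 1)))
          (n - (e.base n (z + 1) - e.total i)), by omega, by omega, by omega, ?_, ?_⟩
        · rw [rank_mid V ha (by omega) (by omega) (by omega), if_pos hdz]; omega
        · rw [rank_mid V ha hx (by omega) (by omega), if_pos hdx]
          have := hprev hdx
          omega
      · refine ⟨n - 1, by omega, by omega, by omega, ?_, ?_⟩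
        · rw [rank_mid V ha (by omega) (by omega) (by omega), if_pos hdz]; omega
        · rw [rank_mid V ha hx (by omega) (by omega), if_neg hdx]; omega
      · have := hnext (by simpa using hdz)
        have := hprev hdx
        refine ⟨max (e.leftEnd n z) (e.leftEnd n (z + 1)), by omega, by omega, by omega, ?_, ?_⟩
        · rw [rank_mid V ha (by omega) (by omega) (by omega), if_neg hdz]; omega
        · rw [rank_mid V ha hx (by omega) (by omega), if_pos hdx]; omega
      · have := hnext (by simpa using hdz)
        refine ⟨n - 1 - (e.total i - e.base n z), by omega, by omega, by omega, ?_, ?_⟩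
        · rw [rank_mid V ha (by omega) (by omega) (by omega), if_neg hdz]; omega
        · rw [rank_mid V ha hx (by omega) (by omega), if_neg hdx]; omega
  · obtain ⟨v, hv⟩ := exists_rank_eq V ha (show e.total i < m * n by
      rw [← total_k V]; omega)
    exact ⟨v, (hmem v).2 (by omega)⟩

theorem Collects.isContiguous {f : Fin m × Fin n → Fin k} (hf : e.Collects f)
    (V : e.Valid m n k) (ha : 0 < side m n k) (hA : 0 < partSize m n k) (H : e.Tidy m n k) :
    IsContiguous f := by
  intro i
  rcases lt_or_ge (i : ℕ) (e.start e.strips) with h | h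
  · exact hf.connected_left V ha hA H.height_lt i h
  · rcases lt_or_ge (e.total i) (e.top e.strips * n) with h' | h'
    · exact hf.connected_mid V ha hA H i h h'
    · exact hf.connected_bottom V ha hA H.bottom_lt H.down i h'

end Choices

/-! ### The stopping window -/

/-- Of the golden ratio only 8/5 ≤ φ ≤ 5/3 and φ < 2 are used, in integer form. -/
theorem eight_mul_lo_le (m n k : ℕ) : 8 * lo m n k ≤ 5 * side m n k := by
  have h5 : (2.2 : ℝ) < √5 := Real.lt_sqrt_of_sq_lt (by norm_num)
  have hφ : (8 / 5 : ℝ) ≤ Real.goldenRatio := by rw [Real.goldenRatio]; linarith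
  have h1 : (lo m n k : ℝ) ≤ (side m n k : ℝ) / Real.goldenRatio := Nat.floor_le (by positivity)
  have h2 : (side m n k : ℝ) / Real.goldenRatio ≤ (side m n k : ℝ) / (8 / 5) := by gcongr
  have h3 : (8 * lo m n k : ℝ) ≤ 5 * side m n k := by linarith
  exact_mod_cast h3

theorem three_mul_side_lt (m n k : ℕ) : 3 * side m n k < 5 * (lo m n k + 1) := by
  have h5 : √5 < (2.3 : ℝ) := (Real.sqrt_lt' (by norm_num)).2 (by norm_num)
  have hφ : Real.goldenRatio ≤ (5 / 3 : ℝ) := by rw [Real.goldenRatio]; linarith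
  have h1 : (side m n k : ℝ) / Real.goldenRatio < lo m n k + 1 := Nat.lt_floor_add_one _
  have h2 : (side m n k : ℝ) / (5 / 3) ≤ (side m n k : ℝ) / Real.goldenRatio := by
    gcongr
  have h3 : (3 * side m n k : ℝ) < 5 * (lo m n k + 1) := by linarith
  exact_mod_cast h3

theorem eight_mul_side_le (m n k : ℕ) : 8 * side m n k ≤ 5 * hi m n k := by
  have h5 : (2.2 : ℝ) < √5 := Real.lt_sqrt_of_sq_lt (by norm_num)
  have hφ : (8 / 5 : ℝ) ≤ Real.goldenRatio := by rw [Real.goldenRatio]; linarith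
  have h1 : Real.goldenRatio * (side m n k : ℝ) ≤ hi m n k := Nat.le_ceil _
  have h2 : (8 / 5 : ℝ) * side m n k ≤ Real.goldenRatio * (side m n k : ℝ) := by gcongr
  have h3 : (8 * side m n k : ℝ) ≤ 5 * hi m n k := by linarith
  exact_mod_cast h3

theorem hi_le_two_mul (m n k : ℕ) : hi m n k ≤ 2 * side m n k := by
  refine Nat.ceil_le.2 ?_
  push_cast
  gcongr
  exact Real.goldenRatio_lt_two.le

theorem bottomHeight_le {m n k : ℕ} (h : 0 < side m n k) :
    bottomHeight m n k ≤ side m n k + lo m n k := by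
  rw [bottomHeight]
  have := Nat.mod_lt m h
  split_ifs <;> omega

/-! ### The sizes of the parts -/

/-- In each block, the ones are put first. -/
theorem exists_indicator_of_sums (q : ℕ) (c l : ℕ → ℕ) (hl : ∀ i < q, l i ≤ c i) :
    ∃ δ : ℕ → ℕ, (∀ t, δ t ≤ 1) ∧ ∀ i < q,
      ∑ t ∈ Ico (∑ j ∈ range i, c j) (∑ j ∈ range (i + 1), c j), δ t = l i := by
  induction q with
  | zero => exact ⟨fun _ => 0, fun _ => Nat.zero_le _, fun i hi => absurd hi (Nat.not_lt_zero i)⟩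
  | succ q ih =>
    obtain ⟨δ, h1, h2⟩ := ih fun i hi => hl i (by omega)
    set S := ∑ j ∈ range q, c j with hS
    refine ⟨fun t => if t < S then δ t else if t < S + l q then 1 else 0, ?_, ?_⟩
    · intro t
      have := h1 t
      simp only
      split_ifs <;> omega
    · intro i hi
      rcases Nat.lt_succ_iff_lt_or_eq.1 hi with h | rfl
      · rw [← h2 i h]
        refine sum_congr rfl fun t ht => ?_
        have h3 := (mem_Ico.1 ht).2
        have h4 : ∑ j ∈ range (i + 1), c j ≤ S :=
          sum_le_sum_of_subset (range_subset_range.2 h)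
        exact if_pos (by omega)
      · have h3 := hl i hi
        rw [sum_range_succ, ← hS, ← sum_Ico_consecutive _ (show S ≤ S + l i by omega) (by omega)]
        have h4 : ∑ t ∈ Ico S (S + l i), (if t < S then δ t else if t < S + l i then 1 else 0) =
            ∑ t ∈ Ico S (S + l i), 1 :=
          sum_congr rfl fun t ht => by
            have := mem_Ico.1 ht
            rw [if_neg (by omega), if_pos (by omega)]
        have h5 : ∑ t ∈ Ico (S + l i) (S + c i),
            (if t < S then δ t else if t < S + l i then 1 else 0) =
            ∑ t ∈ Ico (S + l i) (S + c i), 0 :=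
          sum_congr rfl fun t ht => by
            have := mem_Ico.1 ht
            rw [if_neg (by omega), if_neg (by omega)]
        rw [h4, h5]
        simp

/-- Sizes of the parts with prescribed numbers of small and large parts in each strip. -/
theorem exists_sizes (A q S L : ℕ) (s l : ℕ → ℕ) (hs : ∑ i ∈ range q, s i ≤ S)
    (hl : ∑ i ∈ range q, l i ≤ L) :
    ∃ size : ℕ → ℕ, (∀ t, size t = A ∨ size t = A + 1) ∧
      #((range (S + L)).filter fun t => size t = A + 1) = L ∧
      (∀ i < q, ∑ t ∈ Ico (∑ j ∈ range i, (s j + l j)) (∑ j ∈ range (i + 1), (s j + l j)), size t =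
        s i * A + l i * (A + 1)) ∧
      ∀ t, ∑ i ∈ range q, (s i + l i) ≤ t → t < S + L → size t = A →
        ∑ i ∈ range q, s i < S := by
  have hsl : ∑ i ∈ range q, (s i + l i) = ∑ i ∈ range q, s i + ∑ i ∈ range q, l i :=
    sum_add_distrib
  -- The extra block `q` holds the parts made after Step 2, with all sizes not yet used.
  set c : ℕ → ℕ := fun i => if i < q then s i + l i else S + L - ∑ i ∈ range q, (s i + l i) with hc
  set l' : ℕ → ℕ := fun i => if i < q then l i else L - ∑ i ∈ range q, l i with hl'
  obtain ⟨δ, h1, h2⟩ := exists_indicator_of_sums (q + 1) c l' (by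
    intro i hi
    simp only [hc, hl']
    split_ifs
    · omega
    · omega)
  have hstart : ∀ i ≤ q, ∑ j ∈ range i, c j = ∑ j ∈ range i, (s j + l j) := fun i hi =>
    sum_congr rfl fun j hj => by
      have := mem_range.1 hj
      simp only [hc]
      rw [if_pos (by omega)]
  have hend : ∑ j ∈ range (q + 1), c j = S + L := by
    rw [sum_range_succ, hstart q le_rfl]
    simp only [hc]
    rw [if_neg (lt_irrefl q)]
    omega
  have hpart : ∀ i < q,
      ∑ t ∈ Ico (∑ j ∈ range i, (s j + l j)) (∑ j ∈ range (i + 1), (s j + l j)), δ t = l i := by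
    intro i hi
    have := h2 i (by omega)
    rw [hstart i hi.le, hstart (i + 1) hi] at this
    rw [this]
    simp only [hl']
    rw [if_pos hi]
  have htail : ∑ t ∈ Ico (∑ j ∈ range q, (s j + l j)) (S + L), δ t = L - ∑ i ∈ range q, l i := by
    have := h2 q (by omega)
    rw [hstart q le_rfl, hend] at this
    rw [this]
    simp only [hl']
    rw [if_neg (lt_irrefl q)]
  have hhead : ∀ i ≤ q, ∑ t ∈ range (∑ j ∈ range i, (s j + l j)), δ t = ∑ j ∈ range i, l j := by
    intro i
    induction i with
    | zero => simp
    | succ i ih =>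
      intro hi
      rw [range_eq_Ico, ← sum_Ico_consecutive _ (Nat.zero_le (∑ j ∈ range i, (s j + l j)))
        (sum_le_sum_of_subset (range_subset_range.2 (Nat.le_succ i))), hpart i hi,
        ← range_eq_Ico, ih (by omega), sum_range_succ]
  refine ⟨fun t => A + δ t, ?_, ?_, ?_, ?_⟩
  · intro t
    have := h1 t
    simp only
    omega
  · have e1 : ∀ t, (if A + δ t = A + 1 then 1 else 0) = δ t := by
      intro t
      have := h1 t
      split_ifs <;> omega
    rw [card_filter, sum_congr rfl fun t _ => e1 t, range_eq_Ico,
      ← sum_Ico_consecutive _ (Nat.zero_le (∑ j ∈ range q, (s j + l j))) (by omega), htail,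
      ← range_eq_Ico, hhead q le_rfl]
    omega
  · intro i hi
    have : ∑ j ∈ range (i + 1), (s j + l j) - ∑ j ∈ range i, (s j + l j) = s i + l i := by
      rw [sum_range_succ]; omega
    rw [sum_add_distrib, hpart i hi, sum_const, Nat.card_Ico, this, smul_eq_mul]
    ring
  · intro t ht1 ht2 ht3
    simp only at ht3
    have h0 : δ t = 0 := by omega
    have hlt : ∑ t ∈ Ico (∑ j ∈ range q, (s j + l j)) (S + L), δ t <
        ∑ t ∈ Ico (∑ j ∈ range q, (s j + l j)) (S + L), 1 :=
      sum_lt_sum (fun i _ => h1 i) ⟨t, mem_Ico.2 ⟨ht1, ht2⟩, by omega⟩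
    rw [htail, sum_const, Nat.card_Ico, smul_eq_mul, mul_one] at hlt
    omega

/-- Greedy filling of bins of capacities `T i`, small items first. -/
theorem exists_greedy (A q S L : ℕ) (hA : 0 < A) (T : ℕ → ℕ)
    (hT : ∑ i ∈ range q, T i ≤ S * A + L * (A + 1)) :
    ∃ s l : ℕ → ℕ, ∑ i ∈ range q, s i ≤ S ∧ ∑ i ∈ range q, l i ≤ L ∧
      (∀ i < q, s i * A + l i * (A + 1) ≤ T i ∧ T i < s i * A + l i * (A + 1) + (A + 1)) ∧
      (∑ i ∈ range q, s i < S → ∀ i < q, T i < s i * A + l i * (A + 1) + A) := by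
  induction q with
  | zero => exact ⟨fun _ => 0, fun _ => 0, by simp, by simp, by simp, by simp⟩
  | succ q ih =>
    rw [sum_range_succ] at hT
    obtain ⟨s, l, h1, h2, h3, h4⟩ := ih (by omega)
    have hle : (∑ i ∈ range q, s i) * A + (∑ i ∈ range q, l i) * (A + 1) ≤ ∑ i ∈ range q, T i := by
      rw [sum_mul, sum_mul, ← sum_add_distrib]
      exact sum_le_sum fun i hi => (h3 i (mem_range.1 hi)).1
    obtain ⟨S', hS'⟩ := Nat.exists_eq_add_of_le h1
    obtain ⟨L', hL'⟩ := Nat.exists_eq_add_of_le h2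
    have hrem : T q ≤ S' * A + L' * (A + 1) := by
      rw [hS', hL', add_mul, add_mul] at hT
      omega
    obtain ⟨x, y, hx, hy, hxy1, hxy2, hxy3⟩ : ∃ x y, x ≤ S' ∧ y ≤ L' ∧
        x * A + y * (A + 1) ≤ T q ∧ T q < x * A + y * (A + 1) + (A + 1) ∧
        (x < S' → T q < x * A + y * (A + 1) + A) := by
      -- Either the remaining small items suffice to fill the bin, or all of them are used and large
      -- ones follow.
      rcases le_total (T q) (S' * A) with h | h
      · have e1 := Nat.div_add_mod (T q) A
        have e2 := Nat.mod_lt (T q) hA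
        rw [mul_comm] at e1
        refine ⟨T q / A, 0, Nat.div_le_of_le_mul (by rwa [mul_comm]), Nat.zero_le _, ?_, ?_, ?_⟩ <;>
          omega
      · have e1 := Nat.div_add_mod (T q - S' * A) (A + 1)
        have e2 := Nat.mod_lt (T q - S' * A) (show 0 < A + 1 by omega)
        rw [mul_comm] at e1
        refine ⟨S', (T q - S' * A) / (A + 1), le_rfl,
          Nat.div_le_of_le_mul (by rw [mul_comm (A + 1)]; omega), ?_, ?_, ?_⟩ <;> omega
    have hup : ∀ (g : ℕ → ℕ) (z : ℕ), ∑ i ∈ range (q + 1), Function.update g q z i =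
        ∑ i ∈ range q, g i + z := by
      intro g z
      rw [sum_range_succ, Function.update_self]
      congr 1
      refine sum_congr rfl fun i hi => Function.update_of_ne ?_ _ _
      have := mem_range.1 hi
      omega
    have hne : ∀ i < q, i ≠ q := fun i hi => by omega
    refine ⟨Function.update s q x, Function.update l q y, ?_, ?_, ?_, ?_⟩
    · rw [hup]; omega
    · rw [hup]; omega
    · intro i hi
      rcases Nat.lt_succ_iff_lt_or_eq.1 hi with h | rfl
      · rw [Function.update_of_ne (hne i h), Function.update_of_ne (hne i h)]
        exact h3 i h
      · rw [Function.update_self, Function.update_self]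
        exact ⟨hxy1, hxy2⟩
    · rw [hup]
      intro hlt i hi
      rcases Nat.lt_succ_iff_lt_or_eq.1 hi with h | rfl
      · rw [Function.update_of_ne (hne i h), Function.update_of_ne (hne i h)]
        exact h4 (by omega) i h
      · rw [Function.update_self, Function.update_self]
        exact hxy3 (by omega)

/-- A permutation that sorts the first `b` values of a sequence. -/
theorem exists_perm_sorted (r : ℕ → ℕ) (b : ℕ) : ∃ σ : Equiv.Perm ℕ,
    (∀ i, b ≤ i → σ i = i) ∧ (∀ i < b, σ i < b) ∧
      ∀ i j, i ≤ j → j < b → r (σ i) ≤ r (σ j) := by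
  set τ := Tuple.sort (fun i : Fin b => r i) with hτ
  have hmono := Tuple.monotone_sort (fun i : Fin b => r i)
  rw [← hτ] at hmono
  set σ := τ.extendDomain Fin.equivSubtype with hσ
  have hval : ∀ i (hi : i < b), σ i = τ ⟨i, hi⟩ := by
    intro i hi
    exact Equiv.Perm.extendDomain_apply_subtype τ Fin.equivSubtype hi
  refine ⟨σ, ?_, ?_, ?_⟩
  · intro i hi
    exact Equiv.Perm.extendDomain_apply_not_subtype _ _ (by omega)
  · intro i hi
    rw [hval i hi]
    exact Fin.is_lt _
  · intro i j hij hj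
    rw [hval i (by omega), hval j hj]
    exact hmono (show (⟨i, by omega⟩ : Fin b) ≤ ⟨j, hj⟩ from hij)

/-- Step 1: heights of the strips, with few strips of height `a` if `a` is small. -/
theorem exists_heights (m n k : ℕ) (ha : 0 < side m n k) (ham : side m n k ≤ m) :
    ∃ b c, b * side m n k + c * (side m n k + 1) + bottomHeight m n k = m ∧
      (0 < c → m % side m n k ≤ m / side m n k ∧ 2 ≤ side m n k) ∧
      (side m n k = 2 ∨ side m n k = 3 → b ≤ side m n k) ∧
      (0 < bottomHeight m n k → c = 0 ∧ 3 ≤ side m n k) := by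
  have hdm := Nat.div_add_mod m (side m n k)
  have hr := Nat.mod_lt m ha
  have hd : 1 ≤ m / side m n k := Nat.div_pos ham ha
  have hlo := eight_mul_lo_le m n k
  rw [bottomHeight]
  set a := side m n k
  set d := m / a
  set r := m % a
  split_ifs with h1 h2
  · rcases lt_or_ge a 4 with h | h
    · interval_cases a
      · exact ⟨m, 0, by omega, by omega, by omega, by omega⟩
      -- Modulo `a + 1` the equation reads `b ≡ -m`; the least such `b` is at most `a`.
      · refine ⟨(3 - m % 3) % 3, (m - 2 * ((3 - m % 3) % 3)) / 3, ?_, ?_, ?_, ?_⟩ <;> omega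
      · refine ⟨(4 - m % 4) % 4, (m - 3 * ((4 - m % 4) % 4)) / 4, ?_, ?_, ?_, ?_⟩ <;> omega
    · refine ⟨d - r, r, ?_, by omega, by omega, by omega⟩
      obtain ⟨x, hx⟩ := Nat.exists_eq_add_of_le h1
      rw [hx, Nat.add_sub_cancel_left]
      rw [hx] at hdm
      rw [← hdm]
      ring
  · refine ⟨d, 0, ?_, by omega, by omega, by omega⟩
    rw [mul_comm d]; omega
  · refine ⟨d - 1, 0, ?_, by omega, by omega, by omega⟩
    have : (d - 1) * a + a = a * d := by
      rw [← Nat.succ_mul, mul_comm, Nat.succ_eq_add_one, Nat.sub_add_cancel hd]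
    omega

/-! ### A greedy execution with contiguous parts -/

namespace Choices

/-- The number of complete columns that are to be left in strip `i`; the first `b` strips have
height `a`. -/
noncomputable def target (m n k b i : ℕ) : ℕ := if i < b then lo m n k else max (lo m n k) 2

/-- As many parts as possible are cut off, the first `b` strips have height `a` and the others
`a + 1`, and the first `b` strips are sorted by the number of vertices left. -/
structure Greedy (e : Choices) (m n k b : ℕ) : Prop where
  le_strips : b ≤ e.strips
  height_of_lt : ∀ i < b, e.height i = side m n k
  height_of_le : ∀ i, b ≤ i → e.height i = side m n k + 1
  le_rest : ∀ i < e.strips, target m n k b i * e.height i ≤ e.rest n i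
  rest_lt : ∀ i < e.strips, ∀ t < k, e.start e.strips ≤ t →
    e.rest n i < target m n k b i * e.height i + e.size t
  sorted : ∀ i j, i ≤ j → j < b → e.rest n i ≤ e.rest n j
  down : ∀ y, e.topToBottom y = true

/-- Since small parts are used first, the space left over in a strip is less than the size of any
later part: once a large part has been cut off, no small ones remain. The first `b` strips have
equal capacity, so their contents may be permuted to sort them. -/
theorem exists_valid_greedy {m n k b c : ℕ} (hk : 0 < k) (hkmn : k ≤ m * n)
    (hmn : m ≤ n) (ham : side m n k ≤ m)
    (hsum : b * side m n k + c * (side m n k + 1) + bottomHeight m n k = m)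
    (hc : 0 < c → m % side m n k ≤ m / side m n k ∧ 2 ≤ side m n k) :
    ∃ e : Choices, e.strips = b + c ∧ e.Valid m n k ∧ e.Greedy m n k b := by
  classical
  have ha := side_pos hk hkmn
  have hA : 0 < partSize m n k := Nat.div_pos hkmn hk
  have hAlt := partSize_lt m n k
  have hlo := eight_mul_lo_le m n k
  have hhi := eight_mul_side_le m n k
  have hlo' := three_mul_side_lt m n k
  set a := side m n k with haeq
  set A := partSize m n k with hAeq
  set L := m * n % k with hL
  have hLk : L < k := Nat.mod_lt _ hk
  obtain ⟨S, hS⟩ : ∃ S, S + L = k := ⟨k - L, by omega⟩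
  have harea : S * A + L * (A + 1) = m * n := by
    have : k * A + L = m * n := Nat.div_add_mod _ _
    rw [← this, ← hS]; ring
  set h : ℕ → ℕ := fun i => if i < b then a else a + 1 with hh
  set u : ℕ → ℕ := target m n k b with hu
  set q := b + c with hq
  have hu_lt : ∀ i < b, u i = lo m n k := fun i hi => if_pos hi
  have hu_ge : ∀ i, b ≤ i → u i = max (lo m n k) 2 := fun i hi => if_neg (by omega)
  have hh_lt : ∀ i < b, h i = a := fun i hi => if_pos hi
  have hh_ge : ∀ i, b ≤ i → h i = a + 1 := fun i hi => if_neg (by omega)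
  have hhpos : ∀ i, 0 < h i := by
    intro i
    simp only [hh]
    split_ifs <;> omega
  have hun : ∀ i < q, u i ≤ n := by
    intro i hi
    rcases lt_or_ge i b with h' | h'
    · rw [hu_lt i h']; omega
    · rw [hu_ge i h']
      have := (hc (by omega)).2
      omega
  have hhsum : ∑ i ∈ range q, h i = b * a + c * (a + 1) := by
    rw [hq, sum_range_add]
    congr 1
    · rw [sum_congr rfl fun i hi => hh_lt i (mem_range.1 hi)]
      simp
    · rw [sum_congr rfl fun i _ => hh_ge (b + i) (by omega)]
      simp
  set T : ℕ → ℕ := fun i => (n - u i) * h i with hT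
  have hTsum : ∑ i ∈ range q, T i ≤ S * A + L * (A + 1) := by
    rw [harea]
    calc ∑ i ∈ range q, T i ≤ ∑ i ∈ range q, n * h i :=
          sum_le_sum fun i _ => Nat.mul_le_mul_right _ (Nat.sub_le _ _)
      _ = n * (b * a + c * (a + 1)) := by rw [← mul_sum, hhsum]
      _ ≤ n * m := Nat.mul_le_mul_left n (by omega)
      _ = m * n := mul_comm _ _
  obtain ⟨s, l, hs, hl, hsl, hsmall⟩ := exists_greedy A q S L hA T hTsum
  obtain ⟨σ, hσ1, hσ2, hσ3⟩ := exists_perm_sorted (fun i => T i - (s i * A + l i * (A + 1))) b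
  have hsupp : {i | σ i ≠ i} ⊆ (range q : Finset ℕ) := by
    intro i hi
    by_contra hiq
    exact hi (hσ1 i (by simp at hiq; omega))
  have hsσ : ∑ i ∈ range q, s (σ i) = ∑ i ∈ range q, s i := Equiv.Perm.sum_comp σ _ s hsupp
  have hlσ : ∑ i ∈ range q, l (σ i) = ∑ i ∈ range q, l i := Equiv.Perm.sum_comp σ _ l hsupp
  have hTσ : ∀ i, T (σ i) = T i := by
    intro i
    rcases lt_or_ge i b with h' | h'
    · simp only [hT]
      rw [hu_lt _ (hσ2 i h'), hu_lt _ h', hh_lt _ (hσ2 i h'), hh_lt _ h']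
    · rw [hσ1 i h']
  have hσq : ∀ i < q, σ i < q := by
    intro i hi
    rcases lt_or_ge i b with h' | h'
    · have := hσ2 i h'; omega
    · rwa [hσ1 i h']
  obtain ⟨size, z1, z2, z3, z4⟩ := exists_sizes A q S L (fun i => s (σ i)) (fun i => l (σ i))
    (by rw [hsσ]; exact hs) (by rw [hlσ]; exact hl)
  rw [hS] at z2 z4
  set e : Choices := ⟨q, h, fun i => s (σ i) + l (σ i), size, fun _ => true, fun _ => true⟩ with he
  have hused : ∀ i < q, e.used i = s (σ i) * A + l (σ i) * (A + 1) := z3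
  have hslack1 : ∀ i < q, e.used i ≤ T i ∧ T i < e.used i + (A + 1) := by
    intro i hi
    rw [hused i hi, ← hTσ i]
    exact hsl _ (hσq i hi)
  have hrestT : ∀ i < q, T i + u i * h i = h i * n := by
    intro i hi
    simp only [hT]
    rw [← add_mul, Nat.sub_add_cancel (hun i hi), mul_comm]
  have hrest : ∀ i < q, e.rest n i = u i * h i + (T i - e.used i) := by
    intro i hi
    have h1 := hrestT i hi
    have h2 := hslack1 i hi
    show h i * n - e.used i = _
    omega
  refine ⟨e, rfl, ?_, ?_⟩
  · refine ⟨?_, ?_, ?_, z2, ?_, ?_, ?_, ?_⟩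
    · intro i hi
      change i < q at hi
      rcases lt_or_ge i b with h' | h'
      · exact Or.inl (hh_lt i h')
      · exact Or.inr ⟨(hc (by omega)).1, hh_ge i h'⟩
    · exact (congrArg (· + bottomHeight m n k) hhsum).trans hsum
    · exact fun t _ => z1 t
    · show ∑ i ∈ range q, (s (σ i) + l (σ i)) ≤ k
      rw [sum_add_distrib, hsσ, hlσ]
      omega
    · intro i hi
      have h1 := hrestT i hi
      have h2 := hslack1 i hi
      show e.used i ≤ h i * n
      omega
    · intro i hi
      rw [Nat.le_div_iff_mul_le (hhpos i), hrest i hi]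
      have : lo m n k ≤ u i := by
        rcases lt_or_ge i b with h' | h'
        · rw [hu_lt i h']
        · rw [hu_ge i h']; omega
      have := Nat.mul_le_mul_right (h i) this
      show lo m n k * h i ≤ _
      omega
    · intro i hiq
      change i < q at hiq
      have h2 := hslack1 i hiq
      rw [hrest i hiq]
      by_cases hcase : u i = lo m n k
      · right
        rw [hcase]
        show _ < lo m n k * h i + (A + 1)
        omega
      · left
        have hib : b ≤ i := by
          by_contra hib
          exact hcase (hu_lt i (not_le.1 hib))
        have hui := hu_ge i hib
        have h2' := (hc (by omega)).2
        have hui2 : u i = 2 := by omega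
        rw [← Nat.lt_succ_iff, Nat.div_lt_iff_lt_mul (hhpos i)]
        show _ < _ * h i
        rw [hui2, hh_ge i hib]
        -- Here `lo < 2`, so `a` is 2 or 3 and `a + 2 ≤ hi`; fewer than `2 (a+1) + (a+1)²` cells are
        -- left.
        have h3 : (a + 3) * (a + 1) ≤ (hi m n k).succ * (a + 1) :=
          Nat.mul_le_mul_right _ (by omega)
        have h4 : (a + 3) * (a + 1) = 2 * (a + 1) + (a + 1) * (a + 1) := by ring
        omega
  · refine ⟨Nat.le_add_right b c, hh_lt, hh_ge, ?_, ?_, ?_, fun _ => rfl⟩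
    · intro i hi
      rw [hrest i hi]
      exact Nat.le_add_right _ _
    · intro i hi t ht1 ht2
      have h2 := hslack1 i hi
      rw [hrest i hi]
      show u i * h i + _ < u i * h i + size t
      rcases z1 t with hz | hz
      · have h3 := z4 t ht2 ht1 hz
        rw [hsσ] at h3
        have h4 := hsmall h3 (σ i) (hσq i hi)
        rw [hTσ, ← hused i hi] at h4
        omega
      · omega
    · intro i j hij hj
      have hi : i < b := by omega
      have h1 := hσ3 i j hij hj
      simp only [hTσ] at h1
      rw [← hused i (by omega), ← hused j (by omega)] at h1
      rw [hrest i (by omega), hrest j (by omega), hu_lt i hi, hu_lt j hj, hh_lt i hi, hh_lt j hj]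
      omega

variable {e : Choices} {m n k b : ℕ}

/-- A lower bound on the width of the row after row `z` for a part that begins in row `z` and
ends below it. -/
noncomputable def nextWidth (e : Choices) (m n k z : ℕ) : ℕ :=
  if z + 1 < e.top e.strips then e.width n (z + 1)
  else if bottomHeight m n k = 0 then e.width n z else 2

/-- Row `z` has to be traversed to the right: if it were traversed to the left, the vertices of a
part that begins in it would not be adjacent to the next row. -/
def MustGoRight (e : Choices) (m n k z : ℕ) : Prop :=
  ∃ t < k, e.base n z < e.total t ∧ e.total t < e.base n (z + 1) ∧
    e.base n (z + 1) - e.total t + nextWidth e m n k z ≤ e.width n z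

/-- It implies that at most one part begins strictly inside a row of R and that a part begun in one
row reaches into the next. -/
theorem Greedy.width_lt_size (G : e.Greedy m n k b) (V : e.Valid m n k) (ha : 0 < side m n k)
    (h1 : side m n k = 1 → e.strips ≤ b) {z t : ℕ} (hz : z < e.top e.strips) (ht : t < k)
    (hst : e.start e.strips ≤ t) : e.width n z < e.size t := by
  obtain ⟨i, hi, a1, a2⟩ := exists_strip hz
  have hh := height_pos V ha hi
  have hδ := sub_top_lt a1 a2
  have hr := G.rest_lt i hi t ht hst
  have hs := partSize_le_size V ht
  have hA := sq_side_le m n k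
  have hlo := eight_mul_lo_le m n k
  rw [width_eq V ha hi a1 a2, Nat.div_lt_iff_lt_mul hh]
  set a := side m n k with haeq
  -- Equivalent to `target * h ≤ (s - 1) * (h - 1)`. For `a = 1` both sides vanish, as `lo = 0` and
  -- `h1` excludes strips of height 2.
  have key : target m n k b i * e.height i + e.size t + e.height i ≤ e.size t * e.height i + 1 := by
    have aux : ∀ u h s : ℕ, 0 < h → 0 < s → u * h ≤ (s - 1) * (h - 1) →
        u * h + s + h ≤ s * h + 1 := by
      intro u h s hh hs hle
      obtain ⟨h, rfl⟩ := Nat.exists_eq_add_of_le' hh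
      obtain ⟨s, rfl⟩ := Nat.exists_eq_add_of_le' hs
      simp only [Nat.add_sub_cancel] at hle
      nlinarith
    have haa : 0 < a * a := Nat.mul_pos ha ha
    refine aux _ _ _ hh (by omega) ?_
    refine le_trans ?_ (Nat.mul_le_mul_right _ (show a * a - 1 ≤ e.size t - 1 by omega))
    rcases lt_or_ge i b with hib | hib
    · rw [G.height_of_lt i hib, ← haeq, target, if_pos hib]
      rcases Nat.lt_or_ge a 2 with h2 | h2
      · have : lo m n k = 0 := by omega
        rw [this]; simp
      · obtain ⟨x, hx⟩ := Nat.exists_eq_add_of_le' h2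
        have hlox : lo m n k ≤ x + 1 := by omega
        rw [hx]
        have e1 : (x + 2) * (x + 2) - 1 = x * x + 4 * x + 3 := by
          have : (x + 2) * (x + 2) = x * x + 4 * x + 3 + 1 := by ring
          omega
        rw [e1, show x + 2 - 1 = x + 1 by omega]
        calc lo m n k * (x + 2) ≤ (x + 1) * (x + 2) := Nat.mul_le_mul_right _ hlox
          _ = (x + 2) * (x + 1) := by ring
          _ ≤ _ := Nat.mul_le_mul_right _ (by nlinarith)
    · rw [G.height_of_le i hib, ← haeq, target, if_neg (by omega)]
      have h2 : 2 ≤ a := by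
        by_contra h2
        have := h1 (by omega)
        omega
      obtain ⟨x, hx⟩ := Nat.exists_eq_add_of_le' h2
      rw [hx]
      have e1 : (x + 2) * (x + 2) - 1 = (x + 1) * (x + 3) := by
        have : (x + 2) * (x + 2) = (x + 1) * (x + 3) + 1 := by ring
        omega
      rw [e1, show x + 2 + 1 - 1 = x + 2 by omega]
      have hm : max (lo m n k) 2 ≤ (x + 1) * (x + 2) := by
        have : x + 2 ≤ (x + 1) * (x + 2) := by nlinarith
        omega
      calc max (lo m n k) 2 * (x + 2 + 1) ≤ (x + 1) * (x + 2) * (x + 3) :=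
            Nat.mul_le_mul_right _ hm
        _ = _ := by ring
  omega

theorem Greedy.tidy (G : e.Greedy m n k b) (V : e.Valid m n k) (ha : 0 < side m n k)
    (h1 : side m n k = 1 → e.strips ≤ b) (h23 : side m n k = 2 ∨ side m n k = 3 → b ≤ side m n k)
    (hbot : 0 < bottomHeight m n k → e.strips ≤ b ∧ 3 ≤ side m n k)
    (hdir : ∀ z, e.leftToRight z = true ↔ e.MustGoRight m n k z) : e.Tidy m n k := by
  have hA := sq_side_le m n k
  have hlo := eight_mul_lo_le m n k
  have hlo' := three_mul_side_lt m n k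
  have hbh := bottomHeight_le ha
  have hwl := fun (z t : ℕ) => G.width_lt_size V ha h1 (z := z) (t := t)
  have hsq : 2 ≤ side m n k → 2 * side m n k ≤ side m n k * side m n k :=
    fun h => Nat.mul_le_mul_right _ h
  have hsq3 : 3 ≤ side m n k → 3 * side m n k ≤ side m n k * side m n k :=
    fun h => Nat.mul_le_mul_right _ h
  have htgt : 2 ≤ side m n k → ∀ i, 1 ≤ target m n k b i := by
    intro h i
    rw [target]
    split_ifs <;> omega
  have hpos2 : 2 ≤ side m n k → ∀ z < e.top e.strips, 0 < e.width n z := by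
    intro h z hz
    obtain ⟨i, hi, a1, a2⟩ := exists_strip hz
    rw [width_eq V ha hi a1 a2]
    refine Nat.div_pos ?_ (height_pos V ha hi)
    have := Nat.mul_le_mul_right (e.height i) (htgt h i)
    have := G.le_rest i hi
    omega
  -- For `a = 1` each strip is a row, and sorting makes the row lengths monotone.
  have hmono1 : side m n k = 1 → ∀ z z', z ≤ z' → z' < e.top e.strips →
      e.width n z ≤ e.width n z' := by
    intro h z z' hzz hz'
    have hsb := h1 h
    have hhi : ∀ i < e.strips, e.height i = 1 := fun i hi => by
      rw [G.height_of_lt i (by omega), h]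
    obtain ⟨i, hi, a1, a2⟩ := exists_strip (show z < e.top e.strips by omega)
    obtain ⟨j, hj, b1, b2⟩ := exists_strip hz'
    have s1 := sub_top_lt a1 a2
    have s2 := sub_top_lt b1 b2
    have hij : i ≤ j := by
      by_contra hij
      have := e.top_mono (show j + 1 ≤ i by omega)
      omega
    rw [width_eq V ha hi a1 a2, width_eq V ha hj b1 b2, hhi i hi, hhi j hj]
    rw [hhi i hi] at s1
    rw [hhi j hj] at s2
    have := G.sorted i j hij (by omega)
    simp only [Nat.div_one]
    omega
  have huniq : ∀ z < e.top e.strips, ∀ t < k, ∀ t' < k, e.base n z < e.total t →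
      e.total t' < e.base n (z + 1) → t' ≤ t := by
    intro z hz t ht t' ht' h2 h3
    by_contra hlt
    have h4 := e.total_mono (show t + 1 ≤ t' by omega)
    rw [total_succ] at h4
    have h5 : e.start e.strips ≤ t := by
      by_contra h5
      have h6 := e.total_mono (show t ≤ e.start e.strips by omega)
      rw [← e.base_zero n] at h6
      have := e.base_mono n (Nat.zero_le z)
      omega
    have h6 := hwl z t hz ht h5
    have := e.base_succ n z
    omega
  refine ⟨?_, ?_, G.down, ?_, fun z hz t ht => hwl z t hz ht, ?_, ?_, ?_⟩
  · intro i hi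
    rcases lt_or_ge i b with h | h
    · rw [G.height_of_lt i h]
      rcases Nat.lt_or_ge (side m n k) 2 with h2 | h2
      · left; omega
      · right; have := hsq h2; omega
    · rw [G.height_of_le i h]
      right
      have h2 : 2 ≤ side m n k := by
        by_contra h2
        have := h1 (by omega)
        omega
      have := hsq h2
      omega
  · intro h
    have := (hbot h).2
    have := hsq3 (by omega)
    omega
  · intro z z' hzz hz' hw
    rcases Nat.lt_or_ge (side m n k) 2 with h2 | h2
    · exact hw.trans_le (hmono1 (by omega) z z' hzz hz')
    · exact hpos2 h2 z' hz'
  · intro z hz hd t ht h2 h3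
    have hn : ¬ e.MustGoRight m n k z := by rw [← hdir, hd]; simp
    by_contra hlt
    refine hn ⟨t, ht, h2, h3, ?_⟩
    rw [nextWidth, if_pos hz]
    omega
  · intro z hz hd t ht h2 h3
    obtain ⟨t', ht', h2', h3', h4⟩ := (hdir _).1 hd
    obtain rfl : t = t' := le_antisymm (huniq _ hz t' ht' t ht h2' h3) (huniq _ hz t ht t' ht' h2 h3')
    have hbs : e.base n (z + 2) = e.base n (z + 1) + e.width n (z + 1) := e.base_succ n (z + 1)
    change e.total t < e.base n (z + 2) at h3'
    change e.base n (z + 2) - e.total t + nextWidth e m n k (z + 1) ≤ e.width n (z + 1) at h4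
    suffices e.base n (z + 2) - e.total t < e.width n z by omega
    rw [nextWidth] at h4
    rcases Nat.lt_or_ge (side m n k) 2 with ha2 | ha2
    · exfalso
      split_ifs at h4 with c1 c2
      · have := hmono1 (by omega) (z + 1) (z + 1 + 1) (by omega) c1
        omega
      · omega
      · have := (hbot (by omega)).2
        omega
    · obtain ⟨i, hi, a1, a2⟩ := exists_strip hz
      -- Inside a strip the next row is at least as long, so only the last row of a strip can be
      -- forced to the right.
      rcases Nat.lt_or_ge (z + 1 + 1) (e.top (i + 1)) with hlast | hlast
      · exfalso
        have c1 : z + 1 + 1 < e.top e.strips := hlast.trans_le (e.top_mono hi)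
        rw [if_pos c1] at h4
        have := width_le_width_succ V ha hi a1 hlast
        omega
      · have htop := e.top_succ i
        have hh2 : 2 ≤ e.height i := by
          rcases V.height_eq i hi with h | h <;> omega
        have hw := width_le_width_succ V ha (x := z) hi (by omega) a2
        -- Row `z` is in the same strip and at most one shorter than row `z + 1`, so it is enough
        -- that the next width is at least 2. Above S₂ it is 2 by definition; without S₂ the last
        -- row is never forced.
        split_ifs at h4 with c1 c2
        · have hi1 : i + 1 < e.strips := by
            by_contra hi1
            have : i + 1 = e.strips := by omega
            rw [this] at hlast
            omega
          have htop1 := e.top_succ (i + 1)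
          have hh1 := height_pos V ha hi1
          have hw1 := width_eq V ha (x := z + 1 + 1) hi1 (by omega) (by omega)
          have hr1 := G.le_rest (i + 1) hi1
          by_contra hnot
          -- The next strip begins with a row of length at most 1. Then its target is below 2, so it
          -- is one of the first `b` strips, and `a ≤ 3`, `b ≤ a`. By sorting, the strips up to `i`
          -- leave at most `a + 1` cells each, together at most `(a-1)(a+1) < A`: the first part
          -- made in R covers them all, and no part begins in row `z + 1`.
          have hw2 : e.width n (z + 1 + 1) < 2 := by omega
          rw [hw1, Nat.div_lt_iff_lt_mul hh1] at hw2
          have htg : target m n k b (i + 1) < 2 := by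
            by_contra htg
            have := Nat.mul_le_mul_right (e.height (i + 1)) (not_lt.1 htg)
            omega
          have hib : i + 1 < b := by
            by_contra hib
            rw [target, if_neg hib] at htg
            omega
          rw [target, if_pos hib] at htg
          have hb := h23 (by omega)
          rw [G.height_of_lt (i + 1) hib] at hw2
          have hwx := width_eq V ha hi a1 a2
          have hwz := width_eq V ha (x := z) hi (by omega) (by omega)
          have hhi := G.height_of_lt i (by omega)
          rw [hhi] at hwx hwz hh2 htop
          have hsor : ∀ j ≤ i, e.rest n j ≤ e.rest n i := fun j hj => G.sorted j i hj (by omega)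
          have hle : e.rest n i < 2 * side m n k := by
            have := G.sorted i (i + 1) (by omega) hib
            omega
          have hwx3 : e.width n (z + 1) < 3 := by
            rw [hwx, Nat.div_lt_iff_lt_mul ha]
            omega
          have hpz := hpos2 ha2 z (by omega)
          have hpz2 := hpos2 ha2 (z + 1 + 1) c1
          have hwz2 : e.width n z < 2 := by omega
          rw [hwz, Nat.div_lt_iff_lt_mul ha] at hwz2
          have hri : e.rest n i ≤ side m n k + 1 := by omega
          have hbase : ∀ j ≤ i + 1, e.base n (e.top j) ≤ e.base n 0 + j * (side m n k + 1) := by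
            intro j
            induction j with
            | zero => intro _; simp [top]
            | succ j ih =>
              intro hj
              rw [base_top_succ V ha (by omega), add_mul, one_mul]
              have := ih (by omega)
              have := hsor j (by omega)
              omega
          have hbi := hbase (i + 1) le_rfl
          rw [show e.top (i + 1) = z + 2 by omega] at hbi
          have h5 : e.start e.strips < t := by
            by_contra h5
            have h6 := e.total_mono (show t ≤ e.start e.strips by omega)
            rw [← e.base_zero n] at h6
            have := e.base_mono n (Nat.zero_le (z + 1))
            omega
          have h6 := e.total_mono (show e.start e.strips + 1 ≤ t from h5)
          rw [total_succ, ← e.base_zero n] at h6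
          have h7 := partSize_le_size V (show e.start e.strips < k by omega)
          have h8 : (i + 1) * (side m n k + 1) + 1 ≤ side m n k * side m n k := by
            obtain ⟨x, hx⟩ := Nat.exists_eq_add_of_le' ha2
            rw [hx]
            calc (i + 1) * (x + 2 + 1) + 1 ≤ (x + 1) * (x + 2 + 1) + 1 :=
                  Nat.add_le_add_right (Nat.mul_le_mul_right _ (by omega)) 1
              _ = (x + 2) * (x + 2) := by ring
          omega
        · omega
        · omega
  · intro z hz hb0 hd t ht h2 h3
    have hn : ¬ e.MustGoRight m n k z := by rw [← hdir, hd]; simp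
    have hwz := e.base_succ n z
    have h4 : e.width n z ≤ e.base n (z + 1) - e.total t + 1 := by
      by_contra hlt
      refine hn ⟨t, ht, h2, h3, ?_⟩
      rw [nextWidth, if_neg (by omega), if_neg (by omega)]
      omega
    refine ⟨h4, ?_⟩
    have hz' : z < e.top e.strips := by omega
    have h5 : e.start e.strips ≤ t := by
      by_contra h5
      have h6 := e.total_mono (show t ≤ e.start e.strips by omega)
      rw [← e.base_zero n] at h6
      have := e.base_mono n (Nat.zero_le z)
      omega
    obtain ⟨hsb, ha3⟩ := hbot hb0
    obtain ⟨i, hi, a1, a2⟩ := exists_strip hz'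
    have hδ := sub_top_lt a1 a2
    have hr := G.rest_lt i hi t ht h5
    have hs := partSize_le_size V ht
    have hhi := G.height_of_lt i (by omega)
    have hwe := width_eq V ha hi a1 a2
    rw [hhi] at hwe hr hδ
    rw [target, if_pos (by omega)] at hr
    rw [total_succ]
    suffices e.width n z + bottomHeight m n k ≤ e.size t by omega
    have hkey : e.width n z < e.size t - bottomHeight m n k + 1 := by
      rw [hwe, Nat.div_lt_iff_lt_mul ha]
      have hbs : bottomHeight m n k ≤ e.size t := by
        have := hsq3 ha3
        omega
      obtain ⟨y, hy⟩ := Nat.exists_eq_add_of_le hbs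
      rw [hy, Nat.add_sub_cancel_left]
      have h6 : lo m n k * side m n k + (bottomHeight m n k + y) + side m n k ≤
          (y + 1) * side m n k := by
        -- With a part size `s ≥ a²` this gives `(lo + bottomHeight) * a ≤ s * (a - 1)`, which is
        -- `h6` rearranged.
        have h7 : lo m n k + bottomHeight m n k ≤ side m n k * (side m n k - 1) := by
          obtain ⟨x, hx⟩ := Nat.exists_eq_add_of_le' ha3
          rw [hx, show x + 3 - 1 = x + 2 by omega]
          have : (x + 3) * (x + 2) = x * x + 5 * x + 6 := by ring
          omega
        obtain ⟨x, hx⟩ := Nat.exists_eq_add_of_le' (show 1 ≤ side m n k by omega)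
        rw [hx, Nat.add_sub_cancel] at h7
        rw [hx] at hA ⊢
        have h8 : (x + 1) * (x + 1) ≤ bottomHeight m n k + y := by omega
        nlinarith [Nat.mul_le_mul_right x h8, Nat.mul_le_mul_right (x + 1) h7]
      omega
    have hbs : bottomHeight m n k ≤ e.size t := by
      have := hsq3 ha3
      omega
    omega

end Choices

/-! ### Existence, the explicit ratio and the limit -/

variable {m n k : ℕ}

theorem exists_isOutput_isContiguous (hk : 0 < k) (hkmn : k ≤ m * n) (hmn : m ≤ n)
    (ham : side m n k ≤ m) :
    ∃ f : Fin m × Fin n → Fin k, IsOutput f ∧ IsContiguous f := by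
  classical
  have ha := side_pos hk hkmn
  have hA : 0 < partSize m n k := Nat.div_pos hkmn hk
  obtain ⟨b, c, hsum, hc, h23, hbot⟩ := exists_heights m n k ha ham
  obtain ⟨e₀, hq, V₀, G₀⟩ := Choices.exists_valid_greedy hk hkmn hmn ham hsum hc
  -- `MustGoRight` depends on sizes and widths only, so the directions can be chosen afterwards.
  set e : Choices := { e₀ with leftToRight := fun z => decide (e₀.MustGoRight m n k z) } with he
  have V : e.Valid m n k := ⟨V₀.height_eq, V₀.height_sum, V₀.size_eq, V₀.card_large, V₀.start_le,
    V₀.used_le, V₀.lo_le, V₀.le_hi⟩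
  have G : e.Greedy m n k b := ⟨G₀.le_strips, G₀.height_of_lt, G₀.height_of_le, G₀.le_rest,
    G₀.rest_lt, G₀.sorted, G₀.down⟩
  have hq' : e.strips = b + c := hq
  have H : e.Tidy m n k := G.tidy V ha (fun h => by omega) h23
    (fun h => by have := hbot h; omega) fun z => decide_eq_true_iff
  obtain ⟨f, hf⟩ := Choices.exists_collects V ha
  exact ⟨f, ⟨e, V, hf, fun _ _ _ _ _ => G.down _⟩, hf.isContiguous V ha hA H⟩

theorem IsOutput.isBalanced {f : Fin m × Fin n → Fin k} (h : IsOutput f) (ha : 0 < side m n k) :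
    IsBalanced f := by
  obtain ⟨e, V, hf, -⟩ := h
  exact Choices.Collects.isBalanced hf V ha

theorem IsBalanced.two_mul_le {f : Fin m × Fin n → Fin k} (h : IsBalanced f) :
    2 * (m * n) ≤ (side m n k + 1) * (cutSize f + m + n) := by
  refine two_mul_le_cutSize f fun i => ?_
  have := partSize_lt m n k
  rw [sq]
  rcases h i with h | h <;> omega

/-- Needs a balanced contiguous partition to exist: the infimum of the empty set would be 0. -/
theorem exists_cutSize_eq_opt (hk : 0 < k) (hkmn : k ≤ m * n) (hmn : m ≤ n)
    (ham : side m n k ≤ m) :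
    ∃ f : Fin m × Fin n → Fin k, IsBalanced f ∧ IsContiguous f ∧ cutSize f = opt m n k := by
  obtain ⟨f, hf, hc⟩ := exists_isOutput_isContiguous hk hkmn hmn ham
  exact Nat.sInf_mem (s := {c | ∃ f : Fin m × Fin n → Fin k,
    IsBalanced f ∧ IsContiguous f ∧ cutSize f = c})
    ⟨_, f, hf.isBalanced (side_pos hk hkmn), hc, rfl⟩

theorem Choices.Valid.width_le {e : Choices} (V : e.Valid m n k) (ha : 2 ≤ side m n k) {x : ℕ}
    (hx : x < e.top e.strips) : e.width n x ≤ 3 * side m n k := by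
  obtain ⟨i, hi, h1, h2⟩ := Choices.exists_strip hx
  have hh := Choices.height_pos V (by omega) hi
  have hδ := Choices.sub_top_lt h1 h2
  have hlo := eight_mul_lo_le m n k
  have hhi := hi_le_two_mul m n k
  rw [Choices.width_eq V (by omega) hi h1 h2, ← Nat.lt_succ_iff, Nat.div_lt_iff_lt_mul hh]
  rcases V.le_hi i hi with h | h
  · rw [← Nat.lt_succ_iff, Nat.div_lt_iff_lt_mul hh] at h
    have h3 : (Nat.succ (Striping.hi m n k) + 1) * e.height i ≤
        (3 * side m n k).succ * e.height i := Nat.mul_le_mul_right _ (by omega)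
    rw [add_mul, one_mul] at h3
    omega
  · have hA := partSize_lt m n k
    have h4 : side m n k ≤ e.height i := by
      rcases V.height_eq i hi with h | h <;> omega
    have h5 := Nat.mul_le_mul_right (side m n k + 2) h4
    have h6 : (side m n k + 1) * (side m n k + 1) = side m n k * (side m n k + 2) + 1 := by ring
    have h7 : (lo m n k + (side m n k + 2) + 1) * e.height i ≤
        (3 * side m n k).succ * e.height i := Nat.mul_le_mul_right _ (by omega)
    rw [add_mul, add_mul, one_mul, mul_comm (side m n k + 2)] at h7
    omega

theorem IsOutput.cutSize_mul_le {f : Fin m × Fin n → Fin k} (h : IsOutput f)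
    (ha : 4 ≤ side m n k) :
    cutSize f * side m n k ^ 2 ≤ (2 * side m n k + 2) * (m * n) +
      side m n k ^ 2 * (21 * m + 9 * n + 12 * side m n k) := by
  obtain ⟨e, V, hf, -⟩ := h
  have hW : ∀ x < e.top e.strips, e.width n x ≤ 3 * side m n k :=
    fun x hx => V.width_le (by omega) hx
  have h1 := Choices.Collects.card_hCuts_mul_le hf V (by omega) hW
  have h2 := Choices.Collects.card_vCuts_mul_le hf V (by omega) hW
  have hb : bottomHeight m n k ≤ 2 * side m n k := by
    have := bottomHeight_le (m := m) (n := n) (k := k) (by omega)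
    have := eight_mul_lo_le m n k
    omega
  have hA := sq_side_le m n k
  have hstrips : e.strips * side m n k ≤ m := by
    have h3 : e.strips * side m n k ≤ e.top e.strips := by
      rw [Choices.top, ← smul_eq_mul, ← card_range e.strips, ← sum_const, card_range]
      refine sum_le_sum fun i hi => ?_
      rcases V.height_eq i (mem_range.1 hi) with h | h <;> omega
    have := V.height_sum
    omega
  rw [cutSize_eq]
  set a := side m n k
  set A := partSize m n k
  set b := bottomHeight m n k
  set H := #(hCuts f)
  set U := #(vCuts f)
  -- Both counts with `W = 3a` and `b ≤ 2a`, sorted by whether a term carries the factor `A`.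
  have key : (H + U) * A ≤ (11 * a + 4 + 2 * m + e.strips * n) * A +
      ((a + 2) * (m * n) + 3 * a * m + 8 * a ^ 2 * n + 18 * a ^ 2 * m + 2 * a * n) := by
    have e1 : n * b ≤ n * (2 * a) := Nat.mul_le_mul_left n hb
    have e2 : 2 * b * (n * b + A) ≤ 2 * (2 * a) * (n * (2 * a) + A) :=
      Nat.mul_le_mul (Nat.mul_le_mul_left 2 hb) (Nat.add_le_add_right e1 A)
    nlinarith
  -- `A` is lowered to `a²`: trivial if `H + U` is below the coefficient of `A`; otherwise the
  -- excess is multiplied by less.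
  have key2 : (H + U) * a ^ 2 ≤ (11 * a + 4 + 2 * m + e.strips * n) * a ^ 2 +
      ((a + 2) * (m * n) + 3 * a * m + 8 * a ^ 2 * n + 18 * a ^ 2 * m + 2 * a * n) := by
    rcases le_total (H + U) (11 * a + 4 + 2 * m + e.strips * n) with h | h
    · exact (Nat.mul_le_mul_right _ h).trans (Nat.le_add_right _ _)
    · obtain ⟨x, hx⟩ := Nat.exists_eq_add_of_le h
      rw [hx, add_mul] at key ⊢
      have := Nat.mul_le_mul_left x hA
      rw [sq]
      rw [sq] at key
      omega
  have k1 : e.strips * n * a ^ 2 ≤ a * (m * n) := by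
    calc e.strips * n * a ^ 2 = (e.strips * a) * (a * n) := by ring
      _ ≤ m * (a * n) := Nat.mul_le_mul_right _ hstrips
      _ = _ := by ring
  have k2 : 3 * a * m ≤ a ^ 2 * m := by
    rw [sq]; exact Nat.mul_le_mul_right m (Nat.mul_le_mul_right a (by omega))
  have k3 : 2 * a * n ≤ a ^ 2 * n := by
    rw [sq]; exact Nat.mul_le_mul_right n (Nat.mul_le_mul_right a (by omega))
  have k4 : (11 * a + 4) * a ^ 2 ≤ 12 * a * a ^ 2 := Nat.mul_le_mul_right _ (by omega)
  nlinarith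

theorem four_mul_le_of_bounds {a m n c o : ℕ} (ha : 4 ≤ a) (h1 : 3 * (a * m) ≤ m * n)
    (h2 : 3 * (a * n) ≤ m * n) (h3 : 9 * (a * a) ≤ m * n)
    (hlow : 2 * (m * n) ≤ (a + 1) * (o + m + n))
    (hup : c * a ^ 2 ≤ (2 * a + 2) * (m * n) + a ^ 2 * (21 * m + 9 * n + 12 * a)) :
    4 * c ≤ 61 * o := by
  set M := m * n
  have e1 : 3 * (c * a ^ 2) ≤ (40 * a + 6) * M := by
    have b1 := Nat.mul_le_mul_left a h1
    have b2 := Nat.mul_le_mul_left a h2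
    have b3 := Nat.mul_le_mul_left a h3
    nlinarith
  have e2 : 4 * a * M ≤ 3 * (a * (a + 1)) * o + 2 * M := by
    have b0 := Nat.mul_le_mul_left (3 * a) hlow
    have b1 := Nat.mul_le_mul_left (a + 1) h1
    have b2 := Nat.mul_le_mul_left (a + 1) h2
    nlinarith
  -- This is `(40a+6)(a+1) / (a(4a-2)) ≤ 61/4`, true for `a ≥ 4` but not for `a = 3`.
  have e3 : 4 * (40 * a + 6) * (a + 1) + 122 * a ≤ 244 * (a * a) := by nlinarith
  have e4 : (3 * a ^ 2 * (a + 1)) * (4 * c) ≤ (3 * a ^ 2 * (a + 1)) * (61 * o) := by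
    have b1 := Nat.mul_le_mul_left (4 * (a + 1)) e1
    have b2 := Nat.mul_le_mul_left (61 * a) e2
    have b3 := Nat.mul_le_mul_right M e3
    nlinarith
  exact le_of_mul_le_mul_left e4 (by positivity)

theorem IsOutput.cutSize_le_opt {f : Fin m × Fin n → Fin k} (h : IsOutput f) (hk : 0 < k)
    (hkmn : k ≤ m * n) (hmn : m ≤ n) (ham : side m n k ≤ m) (ha : 3 ≤ side m n k)
    (hd : 3 ≤ m / side m n k) : (cutSize f : ℝ) ≤ 15.25 * opt m n k := by
  obtain ⟨g, hg, -, hopt⟩ := exists_cutSize_eq_opt hk hkmn hmn ham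
  have hlow := hg.two_mul_le
  rw [hopt] at hlow
  have h3m : 3 * side m n k ≤ m := (Nat.le_div_iff_mul_le (by omega)).1 hd
  have htriv := cutSize_le_two_mul f
  set a := side m n k
  have h1 : 3 * (a * m) ≤ m * n := by
    calc 3 * (a * m) = m * (3 * a) := by ring
      _ ≤ m * n := Nat.mul_le_mul_left m (by omega)
  have h2 : 3 * (a * n) ≤ m * n := by
    calc 3 * (a * n) = 3 * a * n := by ring
      _ ≤ m * n := Nat.mul_le_mul_right n h3m
  have h3 : 9 * (a * a) ≤ m * n := by
    calc 9 * (a * a) = 3 * a * (3 * a) := by ring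
      _ ≤ m * n := Nat.mul_le_mul h3m (by omega)
  suffices 4 * cutSize f ≤ 61 * opt m n k by
    have h4 : (4 * cutSize f : ℝ) ≤ 61 * opt m n k := by exact_mod_cast this
    linarith
  rcases Nat.lt_or_ge a 4 with h4 | h4
  -- Here `m, n ≤ mn/9`, so the lower bound gives `mn ≤ 3.6 OPT`, and `cutSize f ≤ 2mn` suffices.
  · obtain h5 : a = 3 := by omega
    rw [h5] at hlow h1 h2
    omega
  · have hup := h.cutSize_mul_le h4
    refine four_mul_le_of_bounds (m := m) (n := n) (a := a) h4 h1 h2 h3 hlow hup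

theorem ratio_near_one {ε δ X p q : ℝ} (hX : 0 < X) (hδ : δ ≤ 1 / 2) (hδε : δ ≤ ε / 2)
    (hε : 0 < ε) (hp1 : X * (2 - δ) ≤ p) (hp2 : p ≤ X * (2 + δ)) (hq1 : X * (2 - δ) ≤ q)
    (hq2 : q ≤ X * (2 + δ)) : |p / q - 1| < ε := by
  have hq : 0 < q := lt_of_lt_of_le (mul_pos hX (by linarith)) hq1
  rw [div_sub_one hq.ne', abs_div, abs_of_pos hq, div_lt_iff₀ hq, abs_lt]
  have h1 : X * (2 * δ) < ε * (X * (2 - δ)) := by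
    have : 2 * δ < ε * (2 - δ) := by nlinarith
    calc X * (2 * δ) < X * (ε * (2 - δ)) := mul_lt_mul_of_pos_left this hX
      _ = _ := by ring
  have h2 : ε * (X * (2 - δ)) ≤ ε * q := mul_le_mul_of_nonneg_left hq1 hε.le
  constructor <;> nlinarith

/-- With X = mn/a, passing from `a + 1` to `a` costs 2X/N because a ≥ N, and `m`, `n` are at most
X/N each. -/
theorem IsBalanced.le_cutSize {f : Fin m × Fin n → Fin k} (h : IsBalanced f) {N : ℝ} (hN : 0 < N)
    (ha : N ≤ side m n k) (hm : N * side m n k ≤ m) (hn : N * side m n k ≤ n) :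
    (m * n : ℝ) / side m n k * (2 - 4 / N) ≤ cutSize f := by
  have h1 : (2 * (m * n) : ℝ) ≤ (side m n k + 1) * (cutSize f + m + n) := by
    exact_mod_cast h.two_mul_le
  set a : ℝ := (side m n k : ℝ)
  have ha0 : 0 < a := hN.trans_le ha
  have hm0 : (0 : ℝ) < m := lt_of_lt_of_le (mul_pos hN ha0) hm
  have hn0 : (0 : ℝ) < n := lt_of_lt_of_le (mul_pos hN ha0) hn
  set X : ℝ := (m * n : ℝ) / a with hXdef
  have hXa : X * a = m * n := div_mul_cancel₀ _ ha0.ne'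
  have hX : 0 < X := by positivity
  have hmX : (m : ℝ) ≤ X / N := by
    rw [le_div_iff₀ hN, hXdef, le_div_iff₀ ha0]; nlinarith
  have hnX : (n : ℝ) ≤ X / N := by
    rw [le_div_iff₀ hN, hXdef, le_div_iff₀ ha0]; nlinarith
  have h2 : X * (2 - 2 / N) * (a + 1) ≤ 2 * (m * n) := by
    rw [← hXa]
    have h3 : 2 / N * (a + 1) ≥ 2 := by
      rw [ge_iff_le, div_mul_eq_mul_div, le_div_iff₀ hN]; linarith
    nlinarith
  have h3 : X * (2 - 2 / N) ≤ cutSize f + m + n := by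
    have := h2.trans h1
    rw [mul_comm (a + 1)] at this
    exact le_of_mul_le_mul_right this (by linarith)
  have h4 : X * (2 - 4 / N) = X * (2 - 2 / N) - X / N - X / N := by ring
  linarith

/-- 44 = 2 + 21 + 9 + 12: the term 2mn/a² is at most 2X/N, and `m`, `n`, `a` are at most X/N each.
-/
theorem IsOutput.cutSize_le {f : Fin m × Fin n → Fin k} (h : IsOutput f) {N : ℝ} (hN : 4 ≤ N)
    (ha : N ≤ side m n k) (hm : N * side m n k ≤ m) (hn : N * side m n k ≤ n) :
    (cutSize f : ℝ) ≤ (m * n : ℝ) / side m n k * (2 + 44 / N) := by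
  have ha4 : 4 ≤ side m n k := by exact_mod_cast hN.trans ha
  have h1 : (cutSize f * side m n k ^ 2 : ℝ) ≤ (2 * side m n k + 2) * (m * n) +
      side m n k ^ 2 * (21 * m + 9 * n + 12 * side m n k) := by
    exact_mod_cast h.cutSize_mul_le ha4
  set a : ℝ := (side m n k : ℝ)
  have hN0 : 0 < N := by linarith
  have ha0 : 0 < a := hN0.trans_le ha
  have hm0 : (0 : ℝ) < m := lt_of_lt_of_le (mul_pos hN0 ha0) hm
  have hn0 : (0 : ℝ) < n := lt_of_lt_of_le (mul_pos hN0 ha0) hn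
  set X : ℝ := (m * n : ℝ) / a with hXdef
  have hXa : X * a = m * n := div_mul_cancel₀ _ ha0.ne'
  have hX : 0 < X := by positivity
  have hmX : (m : ℝ) ≤ X / N := by
    rw [le_div_iff₀ hN0, hXdef, le_div_iff₀ ha0]; nlinarith
  have hnX : (n : ℝ) ≤ X / N := by
    rw [le_div_iff₀ hN0, hXdef, le_div_iff₀ ha0]; nlinarith
  have haX : a ≤ X / N := by nlinarith
  have h2 : (2 * a + 2) * (m * n) ≤ a ^ 2 * (2 * X + 2 * (X / N)) := by
    rw [← hXa]
    have : X ≤ a * (X / N) := by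
      rw [mul_div_assoc', le_div_iff₀ hN0]; nlinarith
    nlinarith [mul_le_mul_of_nonneg_left this ha0.le]
  have h3 : a ^ 2 * (21 * m + 9 * n + 12 * a) ≤ a ^ 2 * (42 * (X / N)) :=
    mul_le_mul_of_nonneg_left (by linarith) (by positivity)
  have h4 : (cutSize f : ℝ) * a ^ 2 ≤ (2 * X + 44 * (X / N)) * a ^ 2 := by nlinarith
  have h5 := le_of_mul_le_mul_right h4 (by positivity)
  calc (cutSize f : ℝ) ≤ 2 * X + 44 * (X / N) := h5
    _ = X * (2 + 44 / N) := by ring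

end Striping

theorem theorem1 :
    (∀ m n k : ℕ, 0 < k → k ≤ m * n → m ≤ n → Striping.side m n k ≤ m →
      (∃ f : Fin m × Fin n → Fin k, Striping.IsOutput f ∧ Striping.IsContiguous f) ∧
      ∀ f : Fin m × Fin n → Fin k, Striping.IsOutput f →
        Striping.IsBalanced f ∧
        (3 ≤ Striping.side m n k → 3 ≤ m / Striping.side m n k →
          (Striping.cutSize f : ℝ) ≤ 15.25 * (Striping.opt m n k : ℝ))) ∧
    (∀ ε : ℝ, 0 < ε → ∃ N : ℕ, ∀ m n k : ℕ, 0 < k → k ≤ m * n → m ≤ n →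
      N ≤ Striping.side m n k →
      (N : ℝ) ≤ (m : ℝ) / (Striping.side m n k : ℝ) →
      (N : ℝ) ≤ (n : ℝ) / (Striping.side m n k : ℝ) →
      ∀ f : Fin m × Fin n → Fin k, Striping.IsOutput f →
        |(Striping.cutSize f : ℝ) / (Striping.opt m n k : ℝ) - 1| < ε) := by
  refine ⟨fun m n k hk hkmn hmn ham =>
    ⟨Striping.exists_isOutput_isContiguous hk hkmn hmn ham, fun f hf =>
      ⟨hf.isBalanced (Striping.side_pos hk hkmn), hf.cutSize_le_opt hk hkmn hmn ham⟩⟩, ?_⟩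
  intro ε hε
  -- With `N` this large, `44 / N` is at most `1 / 2` and at most `ε / 2`.
  obtain ⟨N, hN⟩ := exists_nat_ge (max 88 (88 / ε))
  have hN1 : (88 : ℝ) ≤ N := (le_max_left _ _).trans hN
  have hN2 : 88 / ε ≤ N := (le_max_right _ _).trans hN
  have hN0 : (0 : ℝ) < N := by linarith
  refine ⟨N, fun m n k hk hkmn hmn ha hm hn f hf => ?_⟩
  have ha0 : (0 : ℝ) < Striping.side m n k := by exact_mod_cast Striping.side_pos hk hkmn
  have haN : (N : ℝ) ≤ Striping.side m n k := by exact_mod_cast ha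
  rw [le_div_iff₀ ha0] at hm hn
  have ham : Striping.side m n k ≤ m := by
    have : (Striping.side m n k : ℝ) ≤ m := by nlinarith
    exact_mod_cast this
  -- The given output need not be contiguous, so OPT is bounded above through a contiguous output
  -- `g`, and below through an optimal partition `o`.
  obtain ⟨o, ho, hoc, hopt⟩ := Striping.exists_cutSize_eq_opt hk hkmn hmn ham
  obtain ⟨g, hg, hgc⟩ := Striping.exists_isOutput_isContiguous hk hkmn hmn ham
  have hog : (Striping.opt m n k : ℝ) ≤ Striping.cutSize g := by
    have : Striping.opt m n k ≤ Striping.cutSize g :=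
      Nat.sInf_le ⟨g, hg.isBalanced (Striping.side_pos hk hkmn), hgc, rfl⟩
    exact_mod_cast this
  have hlow := (hf.isBalanced (Striping.side_pos hk hkmn)).le_cutSize hN0 haN hm hn
  have hlow' := ho.le_cutSize hN0 haN hm hn
  rw [hopt] at hlow'
  have hup := hf.cutSize_le (by linarith) haN hm hn
  have hup' := hog.trans (hg.cutSize_le (by linarith) haN hm hn)
  have hnpos : (0 : ℝ) < n := by nlinarith
  have hmpos : (0 : ℝ) < m := by nlinarith
  have hX : (0 : ℝ) < (m * n : ℝ) / Striping.side m n k := by positivity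
  have hle : (m * n : ℝ) / Striping.side m n k * (2 - 44 / N) ≤
      (m * n : ℝ) / Striping.side m n k * (2 - 4 / N) := by
    refine mul_le_mul_of_nonneg_left ?_ hX.le
    have : 4 / (N : ℝ) ≤ 44 / N := by gcongr; norm_num
    linarith
  refine Striping.ratio_near_one hX (δ := 44 / N) ?_ ?_ hε (hle.trans hlow) hup (hle.trans hlow')
    hup'
  · rw [div_le_iff₀ hN0]; linarith
  · rw [div_le_iff₀ hN0]
    rw [div_le_iff₀ hε] at hN2
    linarith
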